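/- All graphs are finite and simple. A \emph{subdivision} of a graph $H$ is a graph obtained from $H$ by a (possibly empty) sequence of edge subdivisions, where subdividing an edge $uv$ means replacing it by two edges $uw$, $wv$ with a new vertex $w$. A graph $G$ is \emph{$H$-induced-topological-minor-free} if no induced subgraph of $G$ is isomorphic to a subdivision of $H$. Write $H\subseteq_{is} G$ if $H$ is isomorphic to an induced subgraph of $G$, $\omega(G)$ for the clique number and $\mathrm{tw}(G)$ for the treewidth of $G$ (with $\mathrm{tw}=0$ for the graph without vertices). A function $f:\mathbb{N}\to\mathbb{N}$ is a \emph{$(\mathrm{tw},\omega)$-binding function} for a graph class $\mathcal{G}$ if $\mathrm{tw}(G')\le f(\omega(G'))$ for every $G\in\mathcal{G}$ and every induced subgraph $G'$ of $G$; the class $\mathcal{G}$ is \emph{$(\mathrm{tw},\omega)$-bounded} if it has such a function. Let $C_\ell$ be the cycle on $\ell$ vertices and $K_4^-$ the complete graph on four vertices minus one edge (the diamond). For integers $k\ge 1$ and $\ell\ge 0$, let $R(k,\ell)$ be the least positive integer such that every graph with at least $R(k,\ell)$ vertices contains a clique of size $k$ or an independent set of size $\ell$. \textbf{Theorem.} Let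 $H$ be a graph. The class of $H$-induced-topological-minor-free graphs is $(\mathrm{tw},\omega)$-bounded if and only if one of the following conditions holds: \begin{enumerate} \item $H\subseteq_{is} C_3$ or $H\subseteq_{is} C_4$, in which case a binding function is $f(k)=k-1$; \item $H\cong K_4^-$, in which case a binding function is $f(k)=\max\{k-1,2\}$; \item $H$ is edgeless, in which case a binding function is $f(k)=R(k+1,|V(H)|)-2$. \end{enumerate} (Negative values of these expressions are read as $0$; this matters only for $k=0$ or when $H$ has at most one vertex.) -/

import Mathlib

universe u v

namespace TwOmega

/-- A tree decomposition of `G` whose tree has the finite vertex set `ι`. -/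
structure TreeDecomposition {V : Type v} (G : SimpleGraph V) (ι : Type) where
  /-- the underlying tree -/
  tree : SimpleGraph ι
  isTree : tree.IsTree
  /-- the vertex subset associated with a node of the tree -/
  bag : ι → Finset V
  exists_mem_bag : ∀ x : V, ∃ t, x ∈ bag t
  exists_edge_bag : ∀ x y : V, G.Adj x y → ∃ t, x ∈ bag t ∧ y ∈ bag t
  connected_nodes : ∀ x : V, (tree.induce {t | x ∈ bag t}).Connected

/-- The width `max_t |X_t| - 1`. For a graph with no vertices and all bags empty the (truncated)
value is `0`; a graph with a vertex has a nonempty bag, so nothing is truncated there. -/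
def TreeDecomposition.width {V : Type v} {G : SimpleGraph V} {ι : Type} [Fintype ι]
    (D : TreeDecomposition G ι) : ℕ :=
  (Finset.univ.sup fun t => (D.bag t).card) - 1

/-- The treewidth of a (finite) graph: the minimum width of a tree decomposition. -/
noncomputable def treewidth {V : Type v} (G : SimpleGraph V) : ℕ :=
  sInf {w : ℕ | ∃ (ι : Type) (_ : Fintype ι) (D : TreeDecomposition G ι), D.width = w}

/-- The subdivision of the edge `xy`: the edge is removed, and a new vertex `none` is added that
is adjacent exactly to `x` and `y`. -/
def subdivideEdge {V : Type u} (G : SimpleGraph V) (x y : V) : SimpleGraph (Option V) where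
  Adj
    | some a, some b => G.Adj a b ∧ s(a, b) ≠ s(x, y)
    | some a, none => a = x ∨ a = y
    | none, some b => b = x ∨ b = y
    | none, none => False
  symm := ⟨by
    rintro (_ | a) (_ | b) h
    · exact h
    · exact h
    · exact h
    · exact ⟨h.1.symm, by rw [Sym2.eq_swap]; exact h.2⟩⟩
  loopless := ⟨by
    rintro (_ | a) h
    · exact h
    · exact G.loopless.irrefl a h.1⟩

/-- `IsSubdivision H K`: the graph `K` is obtained from `H` by a finite sequence of edge
subdivisions. -/
inductive IsSubdivision {V : Type u} (H : SimpleGraph V) :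
    (W : Type u) → SimpleGraph W → Prop
  | refl : IsSubdivision H V H
  | step {W : Type u} {K : SimpleGraph W} {x y : W} (hK : IsSubdivision H W K)
      (hxy : K.Adj x y) : IsSubdivision H (Option W) (subdivideEdge K x y)

/-- `H` is an induced topological minor of `G`: some subdivision of `H` is (isomorphic to) an
induced subgraph of `G`. -/
def IsInducedTopologicalMinor {U : Type u} {V : Type v} (H : SimpleGraph U)
    (G : SimpleGraph V) : Prop :=
  ∃ (W : Type u) (K : SimpleGraph W), IsSubdivision H W K ∧ K.IsIndContained G

/-- A class of graphs. Only its finite members matter below. -/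
abbrev GraphClass : Type (v + 1) := (V : Type v) → SimpleGraph V → Prop

/-- The class of `H`-induced-topological-minor-free graphs. -/
def itmFree {U : Type u} (H : SimpleGraph U) : GraphClass.{v} :=
  fun _ G => ¬ IsInducedTopologicalMinor H G

/-- `f` is a `(tw, ω)`-binding function for the class `𝒢` of finite graphs. -/
def IsTwOmegaBinding (𝒢 : GraphClass.{v}) (f : ℕ → ℕ) : Prop :=
  ∀ (V : Type v) [Finite V] (G : SimpleGraph V), 𝒢 V G →
    ∀ s : Set V, treewidth (G.induce s) ≤ f (G.induce s).cliqueNum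

/-- The class `𝒢` of finite graphs is `(tw, ω)`-bounded. -/
def IsTwOmegaBounded (𝒢 : GraphClass.{v}) : Prop :=
  ∃ f : ℕ → ℕ, IsTwOmegaBinding 𝒢 f

/-- The graph `K₄⁻`, that is, `K₄` with one edge removed. -/
def diamond : SimpleGraph (Fin 4) :=
  (⊤ : SimpleGraph (Fin 4)).deleteEdges {s(0, 1)}

/-- The Ramsey number `R(k, l)`: the least positive integer `n` such that every graph with at
least `n` vertices has a clique of size `k` or an independent set of size `l`. -/
noncomputable def ramseyNumber (k l : ℕ) : ℕ :=
  sInf {n : ℕ | 0 < n ∧ ∀ m : ℕ, n ≤ m → ∀ G : SimpleGraph (Fin m),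
    (∃ s, G.IsNClique k s) ∨ (∃ s, G.IsNIndepSet l s)}

end TwOmega

/-!
A theta graph consists of `n` internally disjoint paths between two poles. The subdivisions of `C₃`
and `C₄` are theta graphs with two paths, those of the diamond are theta graphs with three paths.

Upper bounds. A graph without holes breaks along separating cliques into complete graphs, and a
graph in which no two vertices are joined by three independent induced paths breaks into complete
graphs and holes; tree decompositions are glued along the separating cliques. If `H` is edgeless,
then Ramsey's theorem bounds the number of vertices, and one bag suffices.

Lower bounds. Complete bipartite graphs and line graphs of toroidal grids have bounded clique number
but unbounded treewidth: any two members of the family of sets `row ∪ column` touch. Hence both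
contain an induced subdivision of `H`. Line graphs are claw-free and a claw of `H` survives in every
subdivision, so `H` is claw-free. A graph with a complete bipartite subdivision is complete
bipartite or a book `K_{1,1,q}`, and the claw-free ones among these are the graphs in the statement.
-/

namespace TwOmega

open SimpleGraph

/-! ### Tree decompositions -/

section Helly

variable {ι : Type*} {T : SimpleGraph ι} {S : Set ι}

theorem exists_walk_support_subset (hS : (T.induce S).Preconnected) {a b : ι} (ha : a ∈ S)
    (hb : b ∈ S) : ∃ p : T.Walk a b, ∀ x ∈ p.support, x ∈ S := by
  obtain ⟨p⟩ := hS ⟨a, ha⟩ ⟨b, hb⟩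
  refine ⟨p.map (Embedding.induce S).toHom, fun x hx => ?_⟩
  obtain ⟨y, -, rfl⟩ := List.mem_map.1 ((Walk.support_map _ p) ▸ hx)
  exact y.2

theorem preconnected_induce_image {κ : Type*} {T' : SimpleGraph κ} (f : T →g T')
    (hS : (T.induce S).Preconnected) : (T'.induce (f '' S)).Preconnected := by
  rintro ⟨_, a, ha, rfl⟩ ⟨_, b, hb, rfl⟩
  exact (hS ⟨a, ha⟩ ⟨b, hb⟩).map (⟨fun x => ⟨f x.1, x.1, x.2, rfl⟩, fun h => f.map_adj h⟩ :
    T.induce S →g T'.induce (f '' S))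

theorem eq_of_mem_support_of_dist_le {r s a : ι} {p : T.Walk r s} (hp : p.length = T.dist r s)
    (ha : a ∈ p.support) (hle : T.dist r s ≤ T.dist r a) : a = s := by
  classical
  by_contra hne
  have h := dist_le (p.takeUntil a ha)
  have hlt := p.length_takeUntil_lt_length ha hne
  omega

theorem mem_support_of_dist_minimal (hT : T.IsTree) (hS : (T.induce S).Preconnected) {r s z : ι}
    (hs : s ∈ S) (hmin : ∀ x ∈ S, T.dist r s ≤ T.dist r x) (hz : z ∈ S) (w : T.Walk r z) :
    s ∈ w.support := by
  classical
  obtain ⟨p, hp, hlen⟩ := hT.connected.exists_path_of_dist r s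
  obtain ⟨q, hqS⟩ := exists_walk_support_subset hS hs hz
  have hq := q.bypass_isPath.support_nodup
  have hpath : (p.append q.bypass).IsPath := by
    rw [Walk.isPath_def, Walk.support_append, List.nodup_append]
    refine ⟨hp.support_nodup, hq.tail, ?_⟩
    rintro a ha _ hb rfl
    have haS := hqS a (q.support_bypass_subset_support (List.mem_of_mem_tail hb))
    rw [eq_of_mem_support_of_dist_le hlen ha (hmin a haS)] at hb
    rw [← Walk.cons_tail_support, List.nodup_cons] at hq
    exact hq.1 hb
  have huniq : p.append q.bypass = w.bypass := congrArg Subtype.val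
    ((hT.isAcyclic.subsingleton_path r z).elim ⟨_, hpath⟩ ⟨_, w.bypass_isPath⟩)
  have hs' : s ∈ (p.append q.bypass).support := by simp
  exact w.support_bypass_subset_support (huniq ▸ hs')

-- Root the tree: of the nodes closest to the root, one per subtree, the deepest is common to all.
theorem exists_mem_of_pairwise_inter {κ : Type*} [Finite κ] (hT : T.IsTree) (S : κ → Set ι)
    (hS : ∀ k, (T.induce (S k)).Preconnected) (h : ∀ k l, (S k ∩ S l).Nonempty) :
    ∃ t, ∀ k, t ∈ S k := by
  obtain ⟨r⟩ := hT.connected.nonempty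
  cases isEmpty_or_nonempty κ
  · exact ⟨r, isEmptyElim⟩
  have hclosest : ∀ k, ∃ s ∈ S k, ∀ x ∈ S k, T.dist r s ≤ T.dist r x := fun k => by
    obtain ⟨s, hs, hmin⟩ := WellFounded.has_min (InvImage.wf (T.dist r) Nat.lt_wfRel.wf) (S k)
      ((h k k).mono Set.inter_subset_left)
    exact ⟨s, hs, fun x hx => not_lt.1 (hmin x hx)⟩
  choose s hs hmin using hclosest
  obtain ⟨k, hk⟩ := Finite.exists_max fun k => T.dist r (s k)
  refine ⟨s k, fun l => ?_⟩
  obtain ⟨z, hzk, hzl⟩ := h k l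
  obtain ⟨p, hp⟩ := hT.connected.exists_walk_length_eq_dist r (s l)
  obtain ⟨q, hq⟩ := exists_walk_support_subset (hS l) (hs l) hzl
  rcases (Walk.mem_support_append_iff _ _).1
    (mem_support_of_dist_minimal hT (hS k) (hs k) (hmin k) hzk (p.append q)) with hmem | hmem
  · exact eq_of_mem_support_of_dist_le hp hmem (hk l) ▸ hs l
  · exact hq _ hmem

end Helly

/-- `G` has a tree decomposition all of whose bags have at most `k` vertices. In contrast to
`treewidth G ≤ k - 1`, no truncated subtraction is involved. -/
def HasTreeDecomposition {V : Type v} (G : SimpleGraph V) (k : ℕ) : Prop :=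
  ∃ (ι : Type) (_ : Fintype ι) (D : TreeDecomposition G ι), ∀ t, (D.bag t).card ≤ k

section HasTreeDecomposition

variable {V : Type v} {G : SimpleGraph V} {k : ℕ}

theorem HasTreeDecomposition.treewidth_le (h : HasTreeDecomposition G k) :
    treewidth G ≤ k - 1 := by
  obtain ⟨ι, hι, D, hD⟩ := h
  exact (Nat.sInf_le ⟨ι, hι, D, rfl⟩ : treewidth G ≤ D.width).trans
    (Nat.sub_le_sub_right (Finset.sup_le fun t _ => hD t) 1)

theorem hasTreeDecomposition_of_card_le [Finite V] (G : SimpleGraph V) (h : Nat.card V ≤ k) :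
    HasTreeDecomposition G k := by
  have := Fintype.ofFinite V
  refine ⟨Unit, inferInstance, ⟨⊥, IsTree.of_subsingleton, fun _ => .univ,
    fun x => ⟨(), Finset.mem_univ x⟩, fun x y _ => ⟨(), Finset.mem_univ x, Finset.mem_univ y⟩,
    fun x => ?_⟩, fun _ => ?_⟩
  · have : Nonempty {_t : Unit | x ∈ (Finset.univ : Finset V)} := ⟨⟨(), Finset.mem_univ x⟩⟩
    exact IsTree.of_subsingleton.connected
  · rwa [Finset.card_univ, ← Nat.card_eq_fintype_card]

theorem hasTreeDecomposition_of_treewidth_le [Finite V] (h : treewidth G ≤ k) :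
    HasTreeDecomposition G (k + 1) := by
  have hne : {w : ℕ | ∃ (ι : Type) (_ : Fintype ι) (D : TreeDecomposition G ι),
      D.width = w}.Nonempty := by
    obtain ⟨ι, hι, D, -⟩ := hasTreeDecomposition_of_card_le G le_rfl
    exact ⟨D.width, ι, hι, D, rfl⟩
  obtain ⟨ι, hι, D, hD⟩ := Nat.sInf_mem hne
  refine ⟨ι, hι, D, fun t => ?_⟩
  have hbag : (D.bag t).card ≤ Finset.univ.sup fun t => (D.bag t).card :=
    Finset.le_sup (f := fun t => (D.bag t).card) (Finset.mem_univ t)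
  have hwidth : D.width ≤ k := hD.trans_le h
  rw [TreeDecomposition.width] at hwidth
  omega

theorem HasTreeDecomposition.of_iso {W : Type*} {G' : SimpleGraph W} (e : G ≃g G')
    (h : HasTreeDecomposition G k) : HasTreeDecomposition G' k := by
  obtain ⟨ι, hι, D, hD⟩ := h
  refine ⟨ι, hι, ⟨D.tree, D.isTree, fun t => (D.bag t).map e.toEquiv.toEmbedding, fun x => ?_,
    fun x y hxy => ?_, fun x => ?_⟩, fun t => (Finset.card_map _).trans_le (hD t)⟩
  · obtain ⟨t, ht⟩ := D.exists_mem_bag (e.symm x)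
    exact ⟨t, Finset.mem_map_equiv.2 ht⟩
  · obtain ⟨t, hx, hy⟩ := D.exists_edge_bag (e.symm x) (e.symm y) (e.symm.map_adj_iff.2 hxy)
    exact ⟨t, Finset.mem_map_equiv.2 hx, Finset.mem_map_equiv.2 hy⟩
  · rw [show {t | x ∈ (D.bag t).map e.toEquiv.toEmbedding} = {t | e.symm x ∈ D.bag t} from
      Set.ext fun t => Finset.mem_map_equiv]
    exact D.connected_nodes (e.symm x)

theorem TreeDecomposition.exists_bag_of_isClique [Finite V] {ι : Type} (D : TreeDecomposition G ι)
    {K : Set V} (hK : G.IsClique K) : ∃ t, ∀ x ∈ K, x ∈ D.bag t := by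
  obtain ⟨t, ht⟩ := exists_mem_of_pairwise_inter D.isTree (fun x : K => {t | x.1 ∈ D.bag t})
    (fun x => (D.connected_nodes x).preconnected) (fun x y => by
      rcases eq_or_ne x y with rfl | hxy
      · exact (D.exists_mem_bag x).imp fun t ht => ⟨ht, ht⟩
      · exact D.exists_edge_bag x y (hK x.2 y.2 (Subtype.coe_ne_coe.2 hxy)))
  exact ⟨t, fun x hx => ht ⟨x, hx⟩⟩

theorem isTree_sum_sup_edge {α β : Type*} [Finite α] [Finite β] {S : SimpleGraph α}
    {T : SimpleGraph β} (hS : S.IsTree) (hT : T.IsTree) (a : α) (b : β) :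
    ((S ⊕g T) ⊔ edge (Sum.inl a) (Sum.inr b)).IsTree := by
  rw [isTree_iff_connected_and_card] at hS hT ⊢
  refine ⟨hS.1.sum_sup_edge hT.1, ?_⟩
  have hsum : Nat.card (S ⊕g T).edgeSet = Nat.card S.edgeSet + Nat.card T.edgeSet := by
    rw [Nat.card_congr edgeSetSumEquiv, Nat.card_sum]
  have hinsert : ((S ⊕g T) ⊔ edge (Sum.inl a) (Sum.inr b)).edgeSet =
      insert s(Sum.inl a, Sum.inr b) (S ⊕g T).edgeSet := by
    rw [edgeSet_sup, edgeSet_edge, sdiff_eq_left.2 (by simp), Set.union_comm, Set.singleton_union]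
  rw [hinsert, Nat.card_coe_set_eq, Set.ncard_insert_of_notMem (by simp), ← Nat.card_coe_set_eq,
    hsum, Nat.card_sum]
  omega

-- If the vertex `x` lies on one side only, the nodes containing it are all on that side.
theorem connected_induce_sum_sup_edge {α β : Type*} {S : SimpleGraph α} {T : SimpleGraph β}
    {s : Set α} {t : Set β} {a : α} {b : β} (hs : (S.induce s).Preconnected)
    (ht : (T.induce t).Preconnected) (hne : s.Nonempty ∨ t.Nonempty)
    (hab : s.Nonempty → t.Nonempty → a ∈ s ∧ b ∈ t) :
    (((S ⊕g T) ⊔ edge (Sum.inl a) (Sum.inr b)).induce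
      (Sum.inl '' s ∪ Sum.inr '' t)).Connected := by
  set R := (S ⊕g T) ⊔ edge (Sum.inl a) (Sum.inr b)
  have hs' : (R.induce (Sum.inl '' s)).Preconnected :=
    preconnected_induce_image (⟨Sum.inl, fun h => by simp [R, h]⟩ : S →g R) hs
  have ht' : (R.induce (Sum.inr '' t)).Preconnected :=
    preconnected_induce_image (⟨Sum.inr, fun h => by simp [R, h]⟩ : T →g R) ht
  rcases s.eq_empty_or_nonempty with rfl | hsne <;> rcases t.eq_empty_or_nonempty with rfl | htne
  · simp at hne
  · rw [Set.image_empty, Set.empty_union]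
    exact Connected.mk ht' (nonempty := (htne.image _).to_subtype)
  · rw [Set.image_empty, Set.union_empty]
    exact Connected.mk hs' (nonempty := (hsne.image _).to_subtype)
  · obtain ⟨ha, hb⟩ := hab hsne htne
    exact connected_induce_union hs' ht' (v := Sum.inl a) (w := Sum.inr b) ⟨a, ha, rfl⟩
      ⟨b, hb, rfl⟩ (by simp [R, edge])

theorem TreeDecomposition.preconnected_nodes {A : Set V} {ι : Type}
    (D : TreeDecomposition (G.induce A) ι) (x : V) :
    (D.tree.induce {t | ∃ hx : x ∈ A, ⟨x, hx⟩ ∈ D.bag t}).Preconnected := by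
  by_cases hx : x ∈ A
  · rw [show {t | ∃ hx : x ∈ A, ⟨x, hx⟩ ∈ D.bag t} = {t | ⟨x, hx⟩ ∈ D.bag t} by simp [hx]]
    exact (D.connected_nodes ⟨x, hx⟩).preconnected
  · exact fun t => absurd t.2.1 hx

theorem HasTreeDecomposition.glue [Finite V] {A B : Set V} (hAB : A ∪ B = Set.univ)
    (hK : G.IsClique (A ∩ B)) (hadj : ∀ x ∈ A, x ∉ B → ∀ y ∈ B, y ∉ A → ¬ G.Adj x y)
    (hA : HasTreeDecomposition (G.induce A) k) (hB : HasTreeDecomposition (G.induce B) k) :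
    HasTreeDecomposition G k := by
  obtain ⟨ι, hι, D, hD⟩ := hA
  obtain ⟨κ, hκ, E, hE⟩ := hB
  obtain ⟨a, ha⟩ := D.exists_bag_of_isClique (K := {x | x.1 ∈ B}) fun x hx y hy hxy =>
    hK ⟨x.2, hx⟩ ⟨y.2, hy⟩ (Subtype.coe_ne_coe.2 hxy)
  obtain ⟨b, hb⟩ := E.exists_bag_of_isClique (K := {x | x.1 ∈ A}) fun x hx y hy hxy =>
    hK ⟨hx, x.2⟩ ⟨hy, y.2⟩ (Subtype.coe_ne_coe.2 hxy)
  let bag : ι ⊕ κ → Finset V := Sum.elim (fun t => (D.bag t).map (.subtype _))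
    (fun t => (E.bag t).map (.subtype _))
  have hinl : ∀ {t x}, x ∈ bag (.inl t) ↔ ∃ hx : x ∈ A, ⟨x, hx⟩ ∈ D.bag t := by simp [bag]
  have hinr : ∀ {t x}, x ∈ bag (.inr t) ↔ ∃ hx : x ∈ B, ⟨x, hx⟩ ∈ E.bag t := by simp [bag]
  have hmem : ∀ x, x ∈ A ∨ x ∈ B := Set.eq_univ_iff_forall.1 hAB
  refine ⟨ι ⊕ κ, inferInstance, ⟨_, isTree_sum_sup_edge D.isTree E.isTree a b, bag,
    fun x => ?_, fun x y hxy => ?_, fun x => ?_⟩, ?_⟩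
  · rcases hmem x with hx | hx
    · exact (D.exists_mem_bag ⟨x, hx⟩).elim fun t ht => ⟨.inl t, hinl.2 ⟨hx, ht⟩⟩
    · exact (E.exists_mem_bag ⟨x, hx⟩).elim fun t ht => ⟨.inr t, hinr.2 ⟨hx, ht⟩⟩
  · have hside : (x ∈ A ∧ y ∈ A) ∨ (x ∈ B ∧ y ∈ B) := by grind [hxy.symm]
    rcases hside with ⟨hx, hy⟩ | ⟨hx, hy⟩
    · obtain ⟨t, htx, hty⟩ := D.exists_edge_bag ⟨x, hx⟩ ⟨y, hy⟩ hxy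
      exact ⟨.inl t, hinl.2 ⟨hx, htx⟩, hinl.2 ⟨hy, hty⟩⟩
    · obtain ⟨t, htx, hty⟩ := E.exists_edge_bag ⟨x, hx⟩ ⟨y, hy⟩ hxy
      exact ⟨.inr t, hinr.2 ⟨hx, htx⟩, hinr.2 ⟨hy, hty⟩⟩
  · rw [show {t | x ∈ bag t} = Sum.inl '' {t | x ∈ bag (.inl t)} ∪ Sum.inr '' {t | x ∈ bag (.inr t)}
      by ext (t | t) <;> simp]
    refine connected_induce_sum_sup_edge ?_ ?_ ?_ ?_
    · exact (Set.ext fun t => hinl : {t | x ∈ bag (.inl t)} = _) ▸ D.preconnected_nodes x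
    · exact (Set.ext fun t => hinr : {t | x ∈ bag (.inr t)} = _) ▸ E.preconnected_nodes x
    · exact (hmem x).imp
        (fun hx => (D.exists_mem_bag ⟨x, hx⟩).imp fun t ht => hinl.2 ⟨hx, ht⟩)
        (fun hx => (E.exists_mem_bag ⟨x, hx⟩).imp fun t ht => hinr.2 ⟨hx, ht⟩)
    · rintro ⟨t, ht⟩ ⟨t', ht'⟩
      have hxA := (hinl.1 ht).1
      have hxB := (hinr.1 ht').1
      exact ⟨hinl.2 ⟨hxA, ha _ hxB⟩, hinr.2 ⟨hxB, hb _ hxA⟩⟩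
  · exact Sum.rec (fun t => (Finset.card_map _).trans_le (hD t))
      (fun t => (Finset.card_map _).trans_le (hE t))

theorem isTree_pathGraph (m : ℕ) : (pathGraph (m + 1)).IsTree := by
  have hedge : (pathGraph (m + 1)).edgeSet = Set.range fun i : Fin m => s(i.castSucc, i.succ) := by
    ext e
    induction e with | _ i j
    simp only [mem_edgeSet, pathGraph_adj, Set.mem_range, Sym2.eq_iff, Fin.ext_iff,
      Fin.val_castSucc, Fin.val_succ]
    constructor
    · rintro (h | h)
      · exact ⟨⟨i, by omega⟩, Or.inl ⟨rfl, h⟩⟩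
      · exact ⟨⟨j, by omega⟩, Or.inr ⟨rfl, h⟩⟩
    · rintro ⟨l, h⟩
      omega
  have hinj : Function.Injective fun i : Fin m => s(i.castSucc, i.succ) := fun i j h => by
    simp only [Sym2.eq_iff, Fin.ext_iff, Fin.val_castSucc, Fin.val_succ] at h
    omega
  rw [isTree_iff_connected_and_card, hedge, Nat.card_range_of_injective hinj, Nat.card_fin,
    Nat.card_fin]
  exact ⟨pathGraph_connected m, rfl⟩

theorem preconnected_hasse_induce_of_ordConnected {α : Type*} [LinearOrder α] [SuccOrder α]
    [IsSuccArchimedean α] {s : Set α} (hs : s.OrdConnected) :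
    ((hasse α).induce s).Preconnected := by
  have : (hasse α).induce s = hasse s := by
    ext a b
    have hcov : ∀ a b : s, a.1 ⋖ b.1 ↔ a ⋖ b := fun a b =>
      Set.OrdConnected.apply_covBy_apply_iff (OrderEmbedding.subtype (· ∈ s)) (by simpa using hs)
    simp only [comap_adj, hasse_adj, Function.Embedding.subtype_apply, hcov]
  rw [this]
  exact hasse_preconnected_of_succ s

theorem hasTreeDecomposition_of_path {m : ℕ} (bag : Fin (m + 1) → Finset V)
    (hcard : ∀ t, (bag t).card ≤ k) (hV : ∀ x, ∃ t, x ∈ bag t)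
    (hE : ∀ x y, G.Adj x y → ∃ t, x ∈ bag t ∧ y ∈ bag t)
    (hinterval : ∀ x, {t | x ∈ bag t}.OrdConnected) : HasTreeDecomposition G k :=
  ⟨Fin (m + 1), inferInstance, ⟨pathGraph (m + 1), isTree_pathGraph m, bag, hV, hE, fun x =>
    Connected.mk (preconnected_hasse_induce_of_ordConnected (hinterval x))
      (nonempty := (show {t | x ∈ bag t}.Nonempty from hV x).to_subtype)⟩, hcard⟩

theorem TreeDecomposition.preconnected_induce_nodes {ι : Type} (D : TreeDecomposition G ι)
    {B : Set V} (hB : (G.induce B).Preconnected) :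
    (D.tree.induce {t | ∃ x ∈ B, x ∈ D.bag t}).Preconnected := by
  set S := {t | ∃ x ∈ B, x ∈ D.bag t}
  have hvertex : ∀ (x : B) (t t' : S), x.1 ∈ D.bag t → x.1 ∈ D.bag t' →
      (D.tree.induce S).Reachable t t' := fun x t t' ht ht' => by
    have hle : {t | x.1 ∈ D.bag t} ≤ S := fun s hs => ⟨x, x.2, hs⟩
    exact ((D.connected_nodes x).preconnected ⟨t, ht⟩ ⟨t', ht'⟩).map (induceHomOfLE _ hle).toHom
  have hwalk : ∀ {x y : B} (_ : (G.induce B).Walk x y) (t t' : S), x.1 ∈ D.bag t →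
      y.1 ∈ D.bag t' → (D.tree.induce S).Reachable t t' := by
    intro x y p
    induction p with
    | nil => exact hvertex _
    | @cons x z y h _ ih =>
      intro t t' ht ht'
      obtain ⟨s, hxs, hzs⟩ := D.exists_edge_bag _ _ h
      exact (hvertex x t ⟨s, x, x.2, hxs⟩ ht hxs).trans (ih ⟨s, x, x.2, hxs⟩ t' hzs ht')
  rintro ⟨t, x, hx, ht⟩ ⟨t', y, hy, ht'⟩
  exact (hB ⟨x, hx⟩ ⟨y, hy⟩).elim fun p => hwalk p _ _ ht ht'

theorem TreeDecomposition.exists_bag_inter_bramble {κ : Type*} [Finite κ] {ι : Type}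
    (D : TreeDecomposition G ι) (B : κ → Set V) (hB : ∀ k, (G.induce (B k)).Preconnected)
    (htouch : ∀ k l, ∃ x ∈ B k, ∃ y ∈ B l, x = y ∨ G.Adj x y) :
    ∃ t, ∀ k, ∃ x ∈ B k, x ∈ D.bag t := by
  refine exists_mem_of_pairwise_inter D.isTree (fun k => {t | ∃ x ∈ B k, x ∈ D.bag t})
    (fun k => D.preconnected_induce_nodes (hB k)) fun k l => ?_
  obtain ⟨x, hx, y, hy, rfl | h⟩ := htouch k l
  · exact (D.exists_mem_bag x).imp fun t ht => ⟨⟨x, hx, ht⟩, x, hy, ht⟩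
  · exact (D.exists_edge_bag x y h).imp fun t ht => ⟨⟨x, hx, ht.1⟩, y, hy, ht.2⟩

theorem le_treewidth_of_bramble [Finite V] {κ : Type*} [Finite κ] {n : ℕ} (B : κ → Set V)
    (hB : ∀ k, (G.induce (B k)).Preconnected)
    (htouch : ∀ k l, ∃ x ∈ B k, ∃ y ∈ B l, x = y ∨ G.Adj x y)
    (hcover : ∀ X : Finset V, (∀ k, ∃ x ∈ B k, x ∈ X) → n < X.card) : n ≤ treewidth G := by
  obtain ⟨ι, _, D, hD⟩ := hasTreeDecomposition_of_treewidth_le (G := G) le_rfl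
  obtain ⟨t, ht⟩ := D.exists_bag_inter_bramble B hB htouch
  exact Nat.lt_succ_iff.1 ((hcover _ ht).trans_le (hD t))

end HasTreeDecomposition

/-! ### Subdivisions up to isomorphism -/

section Subdivision

variable {V V' : Type*} {K : SimpleGraph V} {K' : SimpleGraph V'} {x y : V}

@[simp]
theorem subdivideEdge_adj_none_left {b : Option V} :
    (subdivideEdge K x y).Adj none b ↔ b = some x ∨ b = some y := by
  cases b <;> simp [subdivideEdge]

@[simp]
theorem subdivideEdge_adj_none_right {a : Option V} :
    (subdivideEdge K x y).Adj a none ↔ a = some x ∨ a = some y := by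
  cases a <;> simp [subdivideEdge]

@[simp]
theorem subdivideEdge_adj_some {a b : V} :
    (subdivideEdge K x y).Adj (some a) (some b) ↔ K.Adj a b ∧ s(a, b) ≠ s(x, y) :=
  Iff.rfl

/-- Subdivision is functorial for induced embeddings. -/
def subdivideEdgeEmbedding (f : K ↪g K') (x y : V) :
    subdivideEdge K x y ↪g subdivideEdge K' (f x) (f y) where
  toEmbedding := f.toEmbedding.optionMap
  map_rel_iff' := by
    rintro (_ | a) (_ | b) <;> simp

theorem isIndContained_subdivideEdge_of_notMem_range (f : K ↪g K') {x y : V'}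
    (hxy : x ∉ Set.range f ∨ y ∉ Set.range f) : K.IsIndContained (subdivideEdge K' x y) := by
  refine ⟨⟨f.toEmbedding.trans .some, fun {a b} => ?_⟩⟩
  change (subdivideEdge K' x y).Adj (some (f a)) (some (f b)) ↔ _
  simp only [subdivideEdge_adj_some, f.map_adj_iff, ne_eq, Sym2.eq_iff]
  grind

/-- Isomorphic graphs have isomorphic subdivisions. -/
def subdivideEdgeIso (e : K ≃g K') (x y : V) :
    subdivideEdge K x y ≃g subdivideEdge K' (e x) (e y) where
  toEquiv := e.toEquiv.optionCongr
  map_rel_iff' := (subdivideEdgeEmbedding e.toEmbedding x y).map_rel_iff'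

theorem nonempty_iso_subdivideEdge (f : Option V ≃ V')
    (hnone : ∀ a, K'.Adj (f (some a)) (f none) ↔ a = x ∨ a = y)
    (hsome : ∀ a b, K'.Adj (f (some a)) (f (some b)) ↔ K.Adj a b ∧ s(a, b) ≠ s(x, y)) :
    Nonempty (K' ≃g subdivideEdge K x y) := by
  refine ⟨RelIso.symm ⟨f, ?_⟩⟩
  rintro (_ | a) (_ | b)
  · simp
  · simpa [K'.adj_comm (f none)] using hnone b
  · simp [hnone]
  · simp [hsome]

/-- `K` is isomorphic to a subdivision of `H`; unlike in `IsSubdivision`, the vertices of `K` may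
have any type. -/
def IsIsoSubdivision {U : Type u} (H : SimpleGraph U) (K : SimpleGraph V) : Prop :=
  ∃ (W : Type u) (K' : SimpleGraph W), IsSubdivision H W K' ∧ Nonempty (K ≃g K')

theorem IsIsoSubdivision.refl {U : Type u} (H : SimpleGraph U) : IsIsoSubdivision H H :=
  ⟨U, H, .refl, ⟨Iso.refl⟩⟩

theorem IsIsoSubdivision.step {U : Type u} {H : SimpleGraph U} (h : IsIsoSubdivision H K)
    (hxy : K.Adj x y) (e : K' ≃g subdivideEdge K x y) : IsIsoSubdivision H K' := by
  obtain ⟨W, K₀, hK₀, ⟨e₀⟩⟩ := h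
  exact ⟨_, _, hK₀.step (e₀.map_adj_iff.2 hxy), ⟨e.trans (subdivideEdgeIso e₀ x y)⟩⟩

theorem IsIsoSubdivision.isInducedTopologicalMinor {U : Type u} {H : SimpleGraph U}
    {G : SimpleGraph V'} (h : IsIsoSubdivision H K) (hG : K.IsIndContained G) :
    IsInducedTopologicalMinor H G := by
  obtain ⟨W, K₀, hK₀, ⟨e₀⟩⟩ := h
  exact ⟨W, K₀, hK₀, IsIndContained.trans ⟨e₀.symm.toEmbedding⟩ hG⟩

theorem IsSubdivision.exists_isSubdivision_isIndContained {U' : Type u} {U : Type v}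
    {H' : SimpleGraph U'} {H : SimpleGraph U} (hH : H'.IsIndContained H) {W : Type v}
    {K : SimpleGraph W} (hK : IsSubdivision H W K) :
    ∃ (W' : Type u) (K' : SimpleGraph W'), IsSubdivision H' W' K' ∧ K'.IsIndContained K := by
  induction hK with
  | refl => exact ⟨_, _, .refl, hH⟩
  | step _ hxy ih =>
    rename_i x y _
    obtain ⟨W', K', hK', ⟨f⟩⟩ := ih
    by_cases hrange : x ∈ Set.range f ∧ y ∈ Set.range f
    · obtain ⟨⟨x', rfl⟩, ⟨y', rfl⟩⟩ := hrange
      exact ⟨_, _, hK'.step (f.map_adj_iff.1 hxy), ⟨subdivideEdgeEmbedding f x' y'⟩⟩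
    · exact ⟨_, _, hK', isIndContained_subdivideEdge_of_notMem_range f (not_and_or.1 hrange)⟩

theorem IsInducedTopologicalMinor.of_isIndContained {U' : Type u} {U : Type*}
    {H' : SimpleGraph U'} {H : SimpleGraph U} (hH : H'.IsIndContained H)
    (h : IsInducedTopologicalMinor H K) : IsInducedTopologicalMinor H' K := by
  obtain ⟨W, K₀, hK₀, hc⟩ := h
  obtain ⟨W', K₁, hK₁, hc'⟩ := hK₀.exists_isSubdivision_isIndContained hH
  exact ⟨W', K₁, hK₁, hc'.trans hc⟩

end Subdivision

/-! ### Theta graphs -/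

/-- The (generalised) theta graph: two branch vertices `inl false` and `inl true` joined by
internally disjoint paths, the `i`-th of which has the `n i` inner vertices `inr (i, k)`, `k < n i`,
numbered from `inl false` to `inl true`. All paths without inner vertices give the same edge. -/
def thetaGraph {ι : Type u} (n : ι → ℕ) : SimpleGraph (Bool ⊕ {p : ι × ℕ // p.2 < n p.1}) where
  Adj
    | .inl a, .inl b => a ≠ b ∧ ∃ i, n i = 0
    | .inl a, .inr p => (a = false ∧ p.1.2 = 0) ∨ (a = true ∧ p.1.2 + 1 = n p.1.1)
    | .inr p, .inl a => (a = false ∧ p.1.2 = 0) ∨ (a = true ∧ p.1.2 + 1 = n p.1.1)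
    | .inr p, .inr q => p.1.1 = q.1.1 ∧ (p.1.2 + 1 = q.1.2 ∨ q.1.2 + 1 = p.1.2)
  symm := ⟨by
    rintro (a | p) (b | q) h
    · exact ⟨h.1.symm, h.2⟩
    · exact h
    · exact h
    · exact ⟨h.1.symm, h.2.symm⟩⟩
  loopless := ⟨by
    rintro (a | p) h
    · exact h.1 rfl
    · have := h.2
      omega⟩

section ThetaGraph

variable {ι : Type u} {n : ι → ℕ}

@[simp]
theorem thetaGraph_adj_inl_inl {a b : Bool} :
    (thetaGraph n).Adj (.inl a) (.inl b) ↔ a ≠ b ∧ ∃ i, n i = 0 := Iff.rfl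

@[simp]
theorem thetaGraph_adj_inl_inr {a : Bool} {p : {p : ι × ℕ // p.2 < n p.1}} :
    (thetaGraph n).Adj (.inl a) (.inr p) ↔
      (a = false ∧ p.1.2 = 0) ∨ (a = true ∧ p.1.2 + 1 = n p.1.1) := Iff.rfl

@[simp]
theorem thetaGraph_adj_inr_inl {a : Bool} {p : {p : ι × ℕ // p.2 < n p.1}} :
    (thetaGraph n).Adj (.inr p) (.inl a) ↔
      (a = false ∧ p.1.2 = 0) ∨ (a = true ∧ p.1.2 + 1 = n p.1.1) := Iff.rfl

@[simp]
theorem thetaGraph_adj_inr_inr {p q : {p : ι × ℕ // p.2 < n p.1}} :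
    (thetaGraph n).Adj (.inr p) (.inr q) ↔
      p.1.1 = q.1.1 ∧ (p.1.2 + 1 = q.1.2 ∨ q.1.2 + 1 = p.1.2) := Iff.rfl

theorem update_add_one_apply [DecidableEq ι] (n : ι → ℕ) (i j : ι) :
    Function.update n i (n i + 1) j = if j = i then n j + 1 else n j := by
  grind [Function.update_apply]

/-- The vertices of the theta graph whose `i`-th path is one longer: the new vertex `none` becomes
the last inner vertex of that path. -/
def thetaVertexEquiv [DecidableEq ι] (n : ι → ℕ) (i : ι) :
    Option (Bool ⊕ {p : ι × ℕ // p.2 < n p.1}) ≃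
      Bool ⊕ {p : ι × ℕ // p.2 < Function.update n i (n i + 1) p.1} where
  toFun
    | none => .inr ⟨(i, n i), by simp⟩
    | some (.inl b) => .inl b
    | some (.inr p) => .inr ⟨p.1, by grind [update_add_one_apply]⟩
  invFun
    | .inl b => some (.inl b)
    | .inr p => if h : p.1.2 < n p.1.1 then some (.inr ⟨p.1, h⟩) else none
  left_inv := by rintro (_ | b | p) <;> grind
  right_inv := by
    rintro (b | ⟨⟨j, k⟩, h⟩)
    · rfl
    · grind [update_add_one_apply]

theorem exists_subdivideEdge_iso_thetaGraph [DecidableEq ι] (n : ι → ℕ) (i : ι)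
    (hi : ∀ j, n j = 0 → n i = 0 → j = i) :
    ∃ x y, (thetaGraph n).Adj x y ∧
      Nonempty (thetaGraph (Function.update n i (n i + 1)) ≃g
        subdivideEdge (thetaGraph n) x y) := by
  have hedge : (∃ j, (if j = i then n j + 1 else n j) = 0) ↔ (∃ j, n j = 0) ∧ n i ≠ 0 := by
    grind
  by_cases h0 : n i = 0
  · refine ⟨.inl false, .inl true, ⟨by decide, i, h0⟩,
      nonempty_iso_subdivideEdge (thetaVertexEquiv n i) ?_ ?_⟩
    · rintro (b | p) <;> simp only [thetaVertexEquiv, Equiv.coe_fn_mk, thetaGraph_adj_inl_inr,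
        thetaGraph_adj_inr_inr, update_add_one_apply] <;> grind
    · rintro ((_ | _) | p) ((_ | _) | q) <;> simp only [thetaVertexEquiv, Equiv.coe_fn_mk,
        thetaGraph_adj_inl_inl, thetaGraph_adj_inl_inr, thetaGraph_adj_inr_inl,
        thetaGraph_adj_inr_inr, update_add_one_apply, hedge, ne_eq, Sym2.eq_iff] <;> grind
  · refine ⟨.inr ⟨(i, n i - 1), Nat.sub_one_lt h0⟩, .inl true, Or.inr ⟨rfl, by grind⟩,
      nonempty_iso_subdivideEdge (thetaVertexEquiv n i) ?_ ?_⟩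
    · rintro (b | p) <;> simp only [thetaVertexEquiv, Equiv.coe_fn_mk, thetaGraph_adj_inl_inr,
        thetaGraph_adj_inr_inr, update_add_one_apply] <;> grind
    · rintro ((_ | _) | p) ((_ | _) | q) <;> simp only [thetaVertexEquiv, Equiv.coe_fn_mk,
        thetaGraph_adj_inl_inl, thetaGraph_adj_inl_inr, thetaGraph_adj_inr_inl,
        thetaGraph_adj_inr_inr, update_add_one_apply, hedge, ne_eq, Sym2.eq_iff] <;> grind

theorem isIsoSubdivision_thetaGraph [Finite ι] {n₀ n : ι → ℕ} (hn : n₀ ≤ n)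
    (h0 : ∀ i j, n₀ i = 0 → n₀ j = 0 → i = j) :
    IsIsoSubdivision (thetaGraph n₀) (thetaGraph n) := by
  classical
  induction n using WellFoundedLT.induction with | _ n ih
  by_cases hne : n₀ = n
  · exact hne ▸ .refl _
  obtain ⟨i, hi⟩ : ∃ i, n₀ i < n i := by
    by_contra! hle
    exact hne (le_antisymm hn hle)
  set n' := Function.update n i (n i - 1) with hn'
  have hlt : n' < n := update_lt_self_iff.2 (by omega)
  have hle : n₀ ≤ n' := le_update_iff.2 ⟨by omega, fun j _ => hn j⟩
  obtain ⟨x, y, hxy, ⟨e⟩⟩ := exists_subdivideEdge_iso_thetaGraph n' i fun j hj hi' =>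
    h0 j i (Nat.le_zero.1 ((hle j).trans_eq hj)) (Nat.le_zero.1 ((hle i).trans_eq hi'))
  have hupdate : Function.update n' i (n' i + 1) = n := by
    rw [hn', Function.update_self, Function.update_idem, Nat.sub_add_cancel (by omega),
      Function.update_eq_self]
  exact (ih n' hlt hle).step hxy (hupdate ▸ e)

end ThetaGraph

/-! ### Arcs -/

/-- Two disjoint vertex sets without edges between them. -/
def Anticomplete {V : Type*} (G : SimpleGraph V) (A B : Set V) : Prop :=
  ∀ x ∈ A, ∀ y ∈ B, x ≠ y ∧ ¬ G.Adj x y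

/-- The vertices `p 0, …, p (m + 1)` form a path that is induced, except that its ends `p 0` and
`p (m + 1)` may be adjacent; so together with one more vertex, or with another arc between the same
ends, it can close up to an induced cycle. -/
structure IsArc {V : Type*} (G : SimpleGraph V) (m : ℕ) (p : ℕ → V) : Prop where
  ne : ∀ ⦃i j⦄, i < j → j ≤ m + 1 → p i ≠ p j
  adj_iff : ∀ ⦃i j⦄, i < j → j ≤ m + 1 → (i = 0 → j ≤ m) → (G.Adj (p i) (p j) ↔ i + 1 = j)

/-- The connected set `D` contains the interior of a path from `a` to `b`, both outside `D`. -/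
structure Links {V : Type*} (G : SimpleGraph V) (D : Set V) (a b : V) : Prop where
  preconnected : (G.induce D).Preconnected
  notMem_left : a ∉ D
  notMem_right : b ∉ D
  exists_adj_left : ∃ x ∈ D, G.Adj a x
  exists_adj_right : ∃ x ∈ D, G.Adj b x

section Arcs

variable {V : Type*} {G : SimpleGraph V} {A B D : Set V} {a b : V}

theorem Anticomplete.symm (h : Anticomplete G A B) : Anticomplete G B A :=
  fun x hx y hy => ⟨(h y hy x hx).1.symm, fun hxy => (h y hy x hx).2 hxy.symm⟩

theorem Links.symm (h : Links G D a b) : Links G D b a :=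
  ⟨h.preconnected, h.notMem_right, h.notMem_left, h.exists_adj_right, h.exists_adj_left⟩

theorem links_singleton {v : V} (ha : G.Adj a v) (hb : G.Adj b v) : Links G {v} a b :=
  ⟨.of_subsingleton, ha.ne, hb.ne, ⟨v, rfl, ha⟩, ⟨v, rfl, hb⟩⟩

theorem getVert_ne_of_length_eq_dist {w : G.Walk a b} (hw : w.length = G.dist a b) {i j : ℕ}
    (hij : i < j) (hj : j ≤ w.length) : w.getVert i ≠ w.getVert j :=
  fun h => hij.ne ((w.isPath_of_length_eq_dist hw).getVert_injOn (hij.le.trans hj) hj h)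

theorem le_add_one_of_adj_getVert {w : G.Walk a b} (hw : w.length = G.dist a b) {i j : ℕ}
    (hj : j ≤ w.length) (h : G.Adj (w.getVert i) (w.getVert j)) : j ≤ i + 1 := by
  have hshort := G.dist_le ((w.take i).append (Walk.cons h (w.drop j)))
  simp only [Walk.length_append, Walk.length_cons, Walk.take_length, Walk.drop_length] at hshort
  omega

/-- Edges between vertices of `D ∪ {a, b}` with at least one end in `D`: the edge `ab` itself is not
available for a path from `a` to `b` through `D`. -/
def linkGraph (G : SimpleGraph V) (D : Set V) (a b : V) : SimpleGraph V :=
  SimpleGraph.fromRel fun x y => G.Adj x y ∧ x ∈ D ∧ (y ∈ D ∨ y = a ∨ y = b)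

theorem linkGraph_adj {x y : V} : (linkGraph G D a b).Adj x y ↔ G.Adj x y ∧
    (x ∈ D ∧ (y ∈ D ∨ y = a ∨ y = b) ∨ y ∈ D ∧ (x ∈ D ∨ x = a ∨ x = b)) := by
  simp only [linkGraph, SimpleGraph.fromRel_adj, G.adj_comm y x]
  have := G.ne_of_adj (a := x) (b := y)
  tauto

theorem Links.reachable_linkGraph (h : Links G D a b) : (linkGraph G D a b).Reachable a b := by
  obtain ⟨x, hx, hax⟩ := h.exists_adj_left
  obtain ⟨y, hy, hby⟩ := h.exists_adj_right
  have hxy : (linkGraph G D a b).Reachable x y :=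
    (h.preconnected ⟨x, hx⟩ ⟨y, hy⟩).map
      (⟨Subtype.val, fun {x y} hxy => linkGraph_adj.2 ⟨hxy, .inl ⟨x.2, .inl y.2⟩⟩⟩ :
        G.induce D →g linkGraph G D a b)
  exact (Adj.reachable (linkGraph_adj.2 ⟨hax, .inr ⟨hx, .inr (.inl rfl)⟩⟩)).trans
    (hxy.trans (Adj.reachable (linkGraph_adj.2 ⟨hby.symm, .inl ⟨hy, .inr (.inr rfl)⟩⟩)))

theorem not_linkGraph_adj (ha : a ∉ D) (hb : b ∉ D) : ¬ (linkGraph G D a b).Adj a b := by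
  rw [linkGraph_adj]
  tauto

theorem linkGraph_getVert_mem {w : (linkGraph G D a b).Walk a b}
    (hw : w.length = (linkGraph G D a b).dist a b) {i : ℕ} (h0 : 0 < i) (hi : i < w.length) :
    w.getVert i ∈ D := by
  have ha := getVert_ne_of_length_eq_dist hw h0 hi.le
  have hb := getVert_ne_of_length_eq_dist hw hi le_rfl
  rw [w.getVert_zero] at ha
  rw [w.getVert_length] at hb
  have := linkGraph_adj.1 (w.adj_getVert_succ hi)
  tauto

theorem linkGraph_getVert_adj_of_adj {w : (linkGraph G D a b).Walk a b}
    (hw : w.length = (linkGraph G D a b).dist a b) {i j : ℕ} (hij : i < j) (hj : j ≤ w.length)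
    (hends : i = 0 → j < w.length) (h : G.Adj (w.getVert i) (w.getVert j)) :
    (linkGraph G D a b).Adj (w.getVert i) (w.getVert j) := by
  have hmem : ∀ k ≤ w.length, w.getVert k ∈ D ∨ w.getVert k = a ∨ w.getVert k = b := by
    intro k hk
    rcases k.eq_zero_or_pos with rfl | h0
    · exact .inr (.inl w.getVert_zero)
    · rcases hk.eq_or_lt with rfl | hk
      · exact .inr (.inr w.getVert_length)
      · exact .inl (linkGraph_getVert_mem hw h0 hk)
  refine linkGraph_adj.2 ⟨h, ?_⟩
  rcases i.eq_zero_or_pos with rfl | h0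
  · exact .inr ⟨linkGraph_getVert_mem hw hij (hends rfl), hmem 0 w.length.zero_le⟩
  · exact .inl ⟨linkGraph_getVert_mem hw h0 (hij.trans_le hj), hmem j hj⟩

theorem Links.exists_isArc (h : Links G D a b) (hab : a ≠ b) :
    ∃ m p, 1 ≤ m ∧ IsArc G m p ∧ p 0 = a ∧ p (m + 1) = b ∧ ∀ k < m, p (k + 1) ∈ D := by
  obtain ⟨w, hw⟩ := h.reachable_linkGraph.exists_walk_length_eq_dist
  have hlength : 2 ≤ w.length := by
    by_contra! hlt
    obtain h0 | h1 : w.length = 0 ∨ w.length = 1 := by omega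
    · exact hab (w.eq_of_length_eq_zero h0)
    · exact not_linkGraph_adj h.notMem_left h.notMem_right (w.adj_of_length_eq_one h1)
  refine ⟨w.length - 1, w.getVert, by omega, ⟨fun i j hij hj =>
    getVert_ne_of_length_eq_dist hw hij (by omega), fun i j hij hj hends => ⟨fun hG => ?_, ?_⟩⟩,
    w.getVert_zero, by rw [Nat.sub_add_cancel (by omega), w.getVert_length],
    fun k hk => linkGraph_getVert_mem hw k.succ_pos (by omega)⟩
  · exact le_antisymm hij (le_add_one_of_adj_getVert hw (by omega)
      (linkGraph_getVert_adj_of_adj hw hij (by omega) (by omega) hG))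
  · rintro rfl
    exact (linkGraph_adj.1 (w.adj_getVert_succ (by omega))).1

theorem IsArc.adj_left {m k : ℕ} {p : ℕ → V} (hp : IsArc G m p) (hk : k < m) :
    G.Adj (p 0) (p (k + 1)) ↔ k = 0 := by
  rw [hp.adj_iff (by omega) (by omega) (by omega)]
  omega

theorem IsArc.adj_right {m k : ℕ} {p : ℕ → V} (hp : IsArc G m p) (hk : k < m) :
    G.Adj (p (m + 1)) (p (k + 1)) ↔ k + 1 = m := by
  rw [G.adj_comm, hp.adj_iff (by omega) (by omega) (by omega)]
  omega

theorem IsArc.adj_inner {m k l : ℕ} {p : ℕ → V} (hp : IsArc G m p) (hk : k < m) (hl : l < m) :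
    G.Adj (p (k + 1)) (p (l + 1)) ↔ k + 1 = l ∨ l + 1 = k := by
  rcases lt_trichotomy k l with h | rfl | h
  · rw [hp.adj_iff (by omega) (by omega) (by omega)]
    omega
  · simp
  · rw [G.adj_comm, hp.adj_iff (by omega) (by omega) (by omega)]
    omega

theorem thetaGraph_isIndContained {ι : Type*} {n : ι → ℕ} (hab : a ≠ b) (p : ι → ℕ → V)
    (hp : ∀ i, IsArc G (n i) (p i)) (ha : ∀ i, p i 0 = a) (hb : ∀ i, p i (n i + 1) = b)
    (hadj : G.Adj a b ↔ ∃ i, n i = 0)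
    (hdisj : ∀ i j, i ≠ j → ∀ k < n i, ∀ l < n j,
      p i (k + 1) ≠ p j (l + 1) ∧ ¬ G.Adj (p i (k + 1)) (p j (l + 1))) :
    (thetaGraph n).IsIndContained G := by
  have hadjLeft : ∀ i, ∀ k < n i, G.Adj a (p i (k + 1)) ↔ k = 0 := fun i _ hk =>
    ha i ▸ (hp i).adj_left hk
  have hadjRight : ∀ i, ∀ k < n i, G.Adj b (p i (k + 1)) ↔ k + 1 = n i := fun i _ hk =>
    hb i ▸ (hp i).adj_right hk
  have hne : ∀ i, ∀ k < n i, p i (k + 1) ≠ a ∧ p i (k + 1) ≠ b := fun i k hk =>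
    ⟨ha i ▸ ((hp i).ne k.succ_pos (by omega)).symm, hb i ▸ (hp i).ne (by omega) le_rfl⟩
  have hinj : ∀ i, ∀ k < n i, ∀ l < n i, p i (k + 1) = p i (l + 1) → k = l := by
    intro i k hk l hl h
    rcases lt_trichotomy k l with hkl | rfl | hkl
    · exact absurd h ((hp i).ne (by omega) (by omega))
    · rfl
    · exact absurd h.symm ((hp i).ne (by omega) (by omega))
  let f : Bool ⊕ {q : ι × ℕ // q.2 < n q.1} → V :=
    Sum.elim (fun x => if x then b else a) fun q => p q.1.1 (q.1.2 + 1)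
  have hf : Function.Injective f := by
    rintro ((_ | _) | ⟨⟨i, k⟩, hk⟩) ((_ | _) | ⟨⟨j, l⟩, hl⟩) <;>
      simp only [f, Sum.elim_inl, Sum.elim_inr] <;> grind
  have hfadj : ∀ x y, G.Adj (f x) (f y) ↔ (thetaGraph n).Adj x y := by
    rintro ((_ | _) | ⟨⟨i, k⟩, hk⟩) ((_ | _) | ⟨⟨j, l⟩, hl⟩) <;>
      simp only [f, Sum.elim_inl, Sum.elim_inr, thetaGraph_adj_inl_inl, thetaGraph_adj_inl_inr,
        thetaGraph_adj_inr_inl, thetaGraph_adj_inr_inr] <;>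
      grind [IsArc.adj_inner, SimpleGraph.adj_comm, SimpleGraph.irrefl]
  exact ⟨⟨⟨f, hf⟩, hfadj _ _⟩⟩

theorem exists_thetaGraph_of_links {ι : Type*} (hab : a ≠ b) (J : Set ι) (D : ι → Set V)
    (hJ : G.Adj a b ↔ J.Nonempty) (hD : ∀ i ∉ J, Links G (D i) a b)
    (hdisj : ∀ i ∉ J, ∀ j ∉ J, i ≠ j → Anticomplete G (D i) (D j)) :
    ∃ n : ι → ℕ, (∀ i, n i = 0 ↔ i ∈ J) ∧ (thetaGraph n).IsIndContained G := by
  have harc : ∀ i, ∃ m p, (m = 0 ↔ i ∈ J) ∧ IsArc G m p ∧ p 0 = a ∧ p (m + 1) = b ∧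
      ∀ k < m, p (k + 1) ∈ D i := fun i => by
    by_cases hi : i ∈ J
    · exact ⟨0, fun k => if k = 0 then a else b, by simp [hi],
        ⟨by grind, by grind⟩, by simp, by simp, by simp⟩
    · obtain ⟨m, p, hm, hp⟩ := (hD i hi).exists_isArc hab
      exact ⟨m, p, by simp only [hi, iff_false]; omega, hp⟩
  choose n p hn hp ha hb hpD using harc
  refine ⟨n, hn, thetaGraph_isIndContained hab p hp ha hb (by simp only [hJ, hn]; rfl) ?_⟩
  exact fun i j hij k hk l hl => hdisj i (by grind) j (by grind) hij _ (hpD i k hk) _ (hpD j l hl)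

end Arcs

/-! ### Clique separations -/

/-- A separation of `G` along a clique, both of whose sides are proper. -/
structure IsCliqueSeparation {V : Type*} (G : SimpleGraph V) (A B : Set V) : Prop where
  union_eq : A ∪ B = Set.univ
  isClique : G.IsClique (A ∩ B)
  not_adj : ∀ x ∈ A, x ∉ B → ∀ y ∈ B, y ∉ A → ¬ G.Adj x y
  left_ne : A ≠ Set.univ
  right_ne : B ≠ Set.univ

/-- The vertex set of the component of `b` in `G[D]`; it is empty for `b ∉ D`. -/
def componentIn {V : Type*} (G : SimpleGraph V) (D : Set V) (b : V) : Set V :=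
  {w | ∃ p : G.Walk b w, ∀ x ∈ p.support, x ∈ D}

/-- The neighbourhood of a vertex set: the vertices outside `B` with a neighbour in `B`. -/
def outerBoundary {V : Type*} (G : SimpleGraph V) (B : Set V) : Set V :=
  {s | s ∉ B ∧ ∃ w ∈ B, G.Adj s w}

section CliqueSeparation

variable {V : Type*} {G : SimpleGraph V} {B D : Set V} {a b u w : V}

theorem mem_componentIn_self (hb : b ∈ D) : b ∈ componentIn G D b := ⟨.nil, by simpa⟩

theorem componentIn_subset : componentIn G D b ⊆ D := fun w ⟨p, hp⟩ => hp w p.end_mem_support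

theorem mem_componentIn_of_adj (hu : u ∈ componentIn G D b) (hw : w ∈ D) (h : G.Adj u w) :
    w ∈ componentIn G D b := by
  obtain ⟨p, hp⟩ := hu
  refine ⟨p.concat h, fun x hx => ?_⟩
  rw [Walk.support_concat, List.mem_append, List.mem_singleton] at hx
  grind

theorem preconnected_componentIn : (G.induce (componentIn G D b)).Preconnected := by
  classical
  by_cases hb : b ∈ D
  · refine (induce_connected_of_patches b (mem_componentIn_self hb) fun {w} hw => ?_).preconnected
    obtain ⟨p, hp⟩ := hw
    refine ⟨{x | x ∈ p.support}, fun x hx => ⟨p.takeUntil x hx, fun y hy =>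
      hp y (p.support_takeUntil_subset_support hx hy)⟩, p.start_mem_support, p.end_mem_support,
      p.connected_induce_support _ _⟩
  · exact fun x => absurd (x.2.choose_spec b (Walk.start_mem_support _)) hb

theorem notMem_of_mem_outerBoundary_componentIn (h : a ∈ outerBoundary G (componentIn G D b)) :
    a ∉ D := fun haD => by
  obtain ⟨ha, w, hw, haw⟩ := h
  exact ha (mem_componentIn_of_adj hw haD haw.symm)

theorem links_of_mem_outerBoundary {x y : V} (hB : (G.induce B).Preconnected)
    (hx : x ∈ outerBoundary G B) (hy : y ∈ outerBoundary G B) : Links G B x y :=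
  ⟨hB, hx.1, hy.1, hx.2, hy.2⟩

theorem isCliqueSeparation_of_isClique_outerBoundary (hB : B.Nonempty)
    (hclique : G.IsClique (outerBoundary G B)) (hne : B ∪ outerBoundary G B ≠ Set.univ) :
    IsCliqueSeparation G (B ∪ outerBoundary G B) Bᶜ where
  union_eq := by
    rw [Set.union_right_comm, Set.union_compl_self, Set.univ_union]
  isClique := hclique.subset fun _ hx => hx.1.resolve_left hx.2
  not_adj x _ hx y hy hy' hxy := hy' (.inr ⟨hy, x, not_not.1 hx, hxy.symm⟩)
  left_ne := hne
  right_ne := Set.compl_ne_univ.2 hB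

/-- The two links `D` and `{a}` between `x` and `y` close up to a hole. -/
theorem exists_isCliqueSeparation_or_links (hab : a ≠ b) (h : ¬ G.Adj a b) :
    (∃ A B, IsCliqueSeparation G A B) ∨ ∃ a x y D, x ≠ y ∧ ¬ G.Adj x y ∧
      G.Adj a x ∧ G.Adj a y ∧ Links G D x y ∧ Anticomplete G {a} D := by
  set D : Set V := {w | w ≠ a ∧ ¬ G.Adj a w}
  set B := componentIn G D b
  have hb : b ∈ B := mem_componentIn_self ⟨hab.symm, h⟩
  have hboundary : ∀ s ∈ outerBoundary G B, G.Adj a s := by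
    rintro s hs
    have hsD := notMem_of_mem_outerBoundary_componentIn hs
    obtain ⟨-, w, hw, hsw⟩ := hs
    by_contra has
    refine hsD ⟨?_, has⟩
    rintro rfl
    exact (componentIn_subset hw).2 hsw
  by_cases hclique : G.IsClique (outerBoundary G B)
  · refine .inl ⟨_, _, isCliqueSeparation_of_isClique_outerBoundary ⟨b, hb⟩ hclique fun huniv => ?_⟩
    rcases huniv ▸ Set.mem_univ a with ha | ha
    · exact (componentIn_subset ha).1 rfl
    · exact G.irrefl (hboundary a ha)
  · simp only [IsClique, Set.Pairwise, not_forall] at hclique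
    obtain ⟨x, hx, y, hy, hxy, hnadj⟩ := hclique
    refine .inr ⟨a, x, y, B, hxy, hnadj, hboundary x hx, hboundary y hy,
      links_of_mem_outerBoundary preconnected_componentIn hx hy, ?_⟩
    rintro _ rfl w hw
    exact ⟨(componentIn_subset hw).1.symm, (componentIn_subset hw).2⟩

end CliqueSeparation

/-- A hereditary property has to be examined only on the graphs without a clique separation: along
clique separations, tree decompositions can be glued. -/
theorem hasTreeDecomposition_of_atoms {k : ℕ} (P : ∀ V : Type v, SimpleGraph V → Prop)
    (hP : ∀ (V : Type v) (G : SimpleGraph V) (s : Set V), P V G → P s (G.induce s))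
    (hatom : ∀ (V : Type v) [Finite V] (G : SimpleGraph V), P V G →
      (∀ A B, ¬ IsCliqueSeparation G A B) → HasTreeDecomposition G k)
    (V : Type v) [Finite V] (G : SimpleGraph V) (hG : P V G) : HasTreeDecomposition G k := by
  induction hN : Nat.card V using Nat.strong_induction_on generalizing V with | _ N ih
  by_cases h : ∀ A B, ¬ IsCliqueSeparation G A B
  · exact hatom V G hG h
  · push Not at h
    obtain ⟨A, B, hAB⟩ := h
    have hcard : ∀ s : Set V, s ≠ Set.univ → Nat.card s < N := fun s hs =>
      hN ▸ Finite.card_subtype_lt (Set.ne_univ_iff_exists_notMem s |>.1 hs).choose_spec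
    exact .glue hAB.union_eq hAB.isClique hAB.not_adj
      (ih _ (hcard A hAB.left_ne) A _ (hP V G A hG) rfl)
      (ih _ (hcard B hAB.right_ne) B _ (hP V G B hG) rfl)

theorem exists_not_adj_of_cliqueFree {V : Type*} [Finite V] {G : SimpleGraph V} {k : ℕ}
    (hk : G.CliqueFree k) (h : k ≤ Nat.card V) : ∃ a b, a ≠ b ∧ ¬ G.Adj a b := by
  have := Fintype.ofFinite V
  refine ne_top_iff_exists_not_adj.1 ?_
  rintro rfl
  rw [Nat.card_eq_fintype_card] at h
  exact (IsContained.refl _).not_cliqueFree_card (hk.mono h)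

theorem hasTreeDecomposition_of_no_hole {V : Type v} [Finite V] {G : SimpleGraph V} {k : ℕ}
    (hk : G.CliqueFree (k + 1))
    (hG : ∀ n : Fin 2 → ℕ, (∀ i, n i ≠ 0) → ¬ (thetaGraph n).IsIndContained G) :
    HasTreeDecomposition G k := by
  refine hasTreeDecomposition_of_atoms (fun V G => G.CliqueFree (k + 1) ∧
      ∀ n : Fin 2 → ℕ, (∀ i, n i ≠ 0) → ¬ (thetaGraph n).IsIndContained G)
    (fun V G s h => ⟨h.1.comap ⟨(Embedding.induce s).toCopy⟩, fun n hn hc =>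
      h.2 n hn (hc.trans ⟨Embedding.induce s⟩)⟩) ?_ V G ⟨hk, hG⟩
  rintro V _ G ⟨hk, hG⟩ hsep
  refine hasTreeDecomposition_of_card_le G (not_lt.1 fun hlt => ?_)
  obtain ⟨a, b, hab, hadj⟩ := exists_not_adj_of_cliqueFree hk hlt
  rcases exists_isCliqueSeparation_or_links hab hadj with ⟨A, B, hAB⟩ |
    ⟨a, x, y, D, hxy, hnadj, hax, hay, hD, haD⟩
  · exact hsep A B hAB
  · obtain ⟨n, hn, hind⟩ := exists_thetaGraph_of_links hxy ∅ ![D, {a}] (by simpa using hnadj)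
      (by simpa [Fin.forall_fin_two] using ⟨hD, links_singleton hax.symm hay.symm⟩)
      (by simpa [Fin.forall_fin_two] using ⟨haD.symm, haD⟩)
    exact hG n (by simpa using hn) hind

/-! ### Holes -/

/-- The vertices `c 0, …, c (N - 1)` form an induced cycle of length `N ≥ 4`. The enumeration `c` is
continued periodically to `ℤ`, so that a statement about a vertex of the cycle, or about a segment,
never has to distinguish whether it contains the edge closing the cycle. -/
structure IsHole {V : Type*} (G : SimpleGraph V) (N : ℤ) (c : ℤ → V) : Prop where
  four_le : 4 ≤ N
  periodic : Function.Periodic c N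
  ne : ∀ ⦃i j⦄, i < j → j < i + N → c i ≠ c j
  adj_iff : ∀ ⦃i j⦄, i < j → j < i + N → (G.Adj (c i) (c j) ↔ j = i + 1 ∨ j + 1 = i + N)

/-- `G` has no induced theta graph with three paths, where at most one of the paths may be a single
edge. These are the subdivisions of the diamond. -/
def ThetaFree {V : Type*} (G : SimpleGraph V) : Prop :=
  ∀ n : Fin 3 → ℕ, n 1 ≠ 0 → n 2 ≠ 0 → ¬ (thetaGraph n).IsIndContained G

section Holes

variable {V : Type v} {G : SimpleGraph V} {N : ℤ} {c : ℤ → V}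

theorem isHole_of_forall_lt {g : ℤ → V} (h4 : 4 ≤ N)
    (hne : ∀ r s, 0 ≤ r → r < s → s < N → g r ≠ g s)
    (hadj : ∀ r s, 0 ≤ r → r < s → s < N →
      (G.Adj (g r) (g s) ↔ s = r + 1 ∨ r = 0 ∧ s + 1 = N)) :
    IsHole G N fun i => g (i % N) := by
  have hmod : ∀ i j, i < j → j < i + N → i % N < j % N ∧ j - i = j % N - i % N ∨
      j % N < i % N ∧ j - i = j % N - i % N + N := fun i j hij hj => by
    have hquot : j / N = i / N ∨ j / N = i / N + 1 := by
      have hle := Int.ediv_le_ediv (by omega : 0 < N) hij.le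
      have hle' := Int.ediv_le_ediv (by omega : 0 < N) hj.le
      rw [Int.add_ediv_of_dvd_right dvd_rfl, Int.ediv_self (by omega)] at hle'
      omega
    have hi := Int.mul_ediv_add_emod i N
    have hj := Int.mul_ediv_add_emod j N
    rcases hquot with h | h <;> rw [h] at hj <;> grind
  refine ⟨h4, fun i => by simp, fun i j hij hj => ?_, fun i j hij hj => ?_⟩
  all_goals
    have hi0 := Int.emod_nonneg i (by omega : N ≠ 0)
    have hj0 := Int.emod_nonneg j (by omega : N ≠ 0)
    have hiN := Int.emod_lt_of_pos i (by omega : 0 < N)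
    have hjN := Int.emod_lt_of_pos j (by omega : 0 < N)
    rcases hmod i j hij hj with ⟨h, hsub⟩ | ⟨h, hsub⟩
  · exact hne _ _ hi0 h hjN
  · exact (hne _ _ hj0 h hiN).symm
  · rw [hadj _ _ hi0 h hjN]
    omega
  · rw [G.adj_comm, hadj _ _ hj0 h hiN]
    omega

theorem exists_isHole_of_links {a x y : V} {D : Set V} (hxy : x ≠ y) (hnadj : ¬ G.Adj x y)
    (hax : G.Adj a x) (hay : G.Adj a y) (hD : Links G D x y) (haD : Anticomplete G {a} D) :
    ∃ N c, IsHole G N c := by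
  obtain ⟨m, p, hm, hp, rfl, rfl, hpD⟩ := hD.exists_isArc hxy
  have hinner : ∀ k, 0 < k → k < m + 1 → a ≠ p k ∧ ¬ G.Adj a (p k) := fun k h0 hk => by
    obtain ⟨k, rfl⟩ := Nat.exists_eq_succ_of_ne_zero h0.ne'
    exact haD a rfl _ (hpD k (by omega))
  have ha : ∀ k ≤ m + 1, a ≠ p k ∧ (G.Adj a (p k) ↔ k = 0 ∨ k = m + 1) := fun k hk => by
    by_cases h : k = 0 ∨ k = m + 1
    · rcases h with rfl | rfl <;> simp [hax, hay, hax.ne, hay.ne]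
    · simpa [h] using hinner k (by omega) (by omega)
  refine ⟨m + 3, _, isHole_of_forall_lt (g := fun i => if i = 0 then a else p (i - 1).toNat)
    (by omega) (fun r s h0 hrs hs => ?_) fun r s h0 hrs hs => ?_⟩
  all_goals
    rw [if_neg (by omega : s ≠ 0)]
    rcases eq_or_ne r 0 with rfl | hr
  · simpa using (ha _ (by omega)).1
  · simpa [hr] using hp.ne (by omega) (by omega)
  · rw [if_pos rfl, (ha _ (by omega)).2]
    omega
  · rw [if_neg hr]
    by_cases hends : r = 1 ∧ s = m + 2
    · obtain ⟨rfl, rfl⟩ := hends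
      simp only [sub_self, Int.toNat_zero]
      rw [show ((m : ℤ) + 2 - 1).toNat = m + 1 by omega, iff_false_left hnadj]
      omega
    · rw [hp.adj_iff (by omega) (by omega) (by omega)]
      omega

section Segments

variable (hc : IsHole G N c)
include hc

theorem IsHole.adj_add_one (i : ℤ) : G.Adj (c i) (c (i + 1)) :=
  (hc.adj_iff (by omega) (by have := hc.four_le; omega)).2 (.inl rfl)

theorem IsHole.preconnected_image_Icc (l u : ℤ) :
    (G.induce (c '' Set.Icc l u)).Preconnected :=
  preconnected_induce_image ⟨c, by
    rintro i j h
    rcases (SimpleGraph.hasse_adj).1 h with h | h <;> rw [Order.covBy_iff_add_one_eq] at h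
    · exact h ▸ hc.adj_add_one i
    · exact h ▸ (hc.adj_add_one j).symm⟩
    (preconnected_hasse_induce_of_ordConnected Set.ordConnected_Icc)

theorem IsHole.notMem_image_Icc {i l u : ℤ} (hl : i < l) (hu : u < i + N) :
    c i ∉ c '' Set.Icc l u := by
  rintro ⟨j, ⟨hlj, hju⟩, hij⟩
  exact hc.ne (by omega) (by omega) hij.symm

theorem IsHole.anticomplete_image_Icc {l u l' u' : ℤ} (h : u + 1 < l') (h' : u' + 1 < l + N) :
    Anticomplete G (c '' Set.Icc l u) (c '' Set.Icc l' u') := by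
  rintro _ ⟨i, ⟨hli, hiu⟩, rfl⟩ _ ⟨j, ⟨hlj, hju⟩, rfl⟩
  refine ⟨hc.ne (by omega) (by omega), ?_⟩
  rw [hc.adj_iff (by omega) (by omega)]
  omega

theorem IsHole.links_image_Icc {i j : ℤ} (hij : i + 1 < j) (hj : j ≤ i + N) :
    Links G (c '' Set.Icc (i + 1) (j - 1)) (c i) (c j) where
  preconnected := hc.preconnected_image_Icc _ _
  notMem_left := hc.notMem_image_Icc (by omega) (by omega)
  notMem_right := by
    rw [← hc.periodic.sub_eq]
    exact hc.notMem_image_Icc (by omega) (by omega)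
  exists_adj_left := ⟨_, ⟨i + 1, ⟨le_rfl, by omega⟩, rfl⟩, hc.adj_add_one i⟩
  exists_adj_right := ⟨_, ⟨j - 1, ⟨by omega, le_rfl⟩, rfl⟩,
    by simpa using (hc.adj_add_one (j - 1)).symm⟩

end Segments

theorem not_thetaFree_of_adj {a b : V} {D₁ D₂ : Set V} (hab : G.Adj a b) (h₁ : Links G D₁ a b)
    (h₂ : Links G D₂ a b) (h₁₂ : Anticomplete G D₁ D₂) : ¬ ThetaFree G := fun hG => by
  obtain ⟨n, hn, hind⟩ := exists_thetaGraph_of_links (G := G) hab.ne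
    ({0} : Set (Fin 3)) ![∅, D₁, D₂]
    (by simp [hab]) (by simp [Fin.forall_fin_succ, h₁, h₂])
    (by simp [Fin.forall_fin_succ, h₁₂, h₁₂.symm])
  exact hG n (by simp [hn]) (by simp [hn]) hind

theorem not_thetaFree_of_not_adj {a b : V} {D₀ D₁ D₂ : Set V} (hne : a ≠ b) (hab : ¬ G.Adj a b)
    (h₀ : Links G D₀ a b) (h₁ : Links G D₁ a b) (h₂ : Links G D₂ a b)
    (h₀₁ : Anticomplete G D₀ D₁) (h₀₂ : Anticomplete G D₀ D₂) (h₁₂ : Anticomplete G D₁ D₂) :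
    ¬ ThetaFree G := fun hG => by
  obtain ⟨n, hn, hind⟩ := exists_thetaGraph_of_links (G := G) hne (∅ : Set (Fin 3)) ![D₀, D₁, D₂]
    (by simp [hab]) (by simp [Fin.forall_fin_succ, h₀, h₁, h₂])
    (by simp [Fin.forall_fin_succ, h₀₁, h₀₂, h₁₂, h₀₁.symm, h₀₂.symm, h₁₂.symm])
  exact hG n (by simp [hn]) (by simp [hn]) hind

section Ears

variable (hG : ThetaFree G) (hc : IsHole G N c)
include hc

theorem IsHole.exists_between {i : ℤ} {x : V} (hx : x ∈ Set.range c) (hne : x ≠ c i) :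
    ∃ j, i < j ∧ j < i + N ∧ c j = x := by
  obtain ⟨k, rfl⟩ := hx
  obtain ⟨j, ⟨hij, hj⟩, hkj⟩ := hc.periodic.exists_mem_Ico (by have := hc.four_le; omega) k i
  refine ⟨j, hij.lt_of_ne ?_, hj, hkj.symm⟩
  rintro rfl
  exact hne hkj

/-- The ear and the two segments of the hole between its ends form a theta graph; if the ends are
adjacent, then one segment is replaced by the edge between them. -/
theorem IsHole.not_thetaFree_of_ear {x y : V} {D : Set V} (hx : x ∈ Set.range c)
    (hy : y ∈ Set.range c) (hxy : x ≠ y) (hD : Disjoint (Set.range c) D) (hear : Links G D x y)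
    (hatt : ∀ z ∈ Set.range c, (∃ d ∈ D, G.Adj z d) → z = x ∨ z = y) : ¬ ThetaFree G := by
  obtain ⟨i, rfl⟩ := hx
  obtain ⟨j, hij, hj, rfl⟩ := hc.exists_between hy hxy.symm
  have hanti : ∀ l u, (∀ k, l ≤ k → k ≤ u → c k ≠ c i ∧ c k ≠ c j) →
      Anticomplete G (c '' Set.Icc l u) D := by
    rintro l u hlu _ ⟨k, ⟨hlk, hku⟩, rfl⟩ d hd
    have := hlu k hlk hku
    refine ⟨fun h => Set.disjoint_left.1 hD ⟨k, rfl⟩ (h ▸ hd), fun h => ?_⟩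
    have := hatt (c k) ⟨k, rfl⟩ ⟨d, hd, h⟩
    tauto
  have hanti₁ := hanti (i + 1) (j - 1) fun k hk hk' =>
    ⟨(hc.ne (by omega) (by omega)).symm, hc.ne (by omega) (by omega)⟩
  have hanti₂ := hanti (j + 1) (i + N - 1) fun k hk hk' =>
    ⟨(hc.ne (by omega) (by omega)).symm, (hc.ne (by omega) (by omega)).symm⟩
  have hlink₁ : i + 1 < j → Links G (c '' Set.Icc (i + 1) (j - 1)) (c i) (c j) :=
    fun h => hc.links_image_Icc h hj.le
  have hlink₂ : j + 1 < i + N → Links G (c '' Set.Icc (j + 1) (i + N - 1)) (c i) (c j) :=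
    fun h => by simpa only [hc.periodic i] using (hc.links_image_Icc h (by omega)).symm
  have h4 := hc.four_le
  by_cases hadj : G.Adj (c i) (c j)
  · rcases (hc.adj_iff hij hj).1 hadj with h | h
    · exact not_thetaFree_of_adj hadj (hlink₂ (by omega)) hear hanti₂
    · exact not_thetaFree_of_adj hadj (hlink₁ (by omega)) hear hanti₁
  · rw [hc.adj_iff hij hj] at hadj
    exact not_thetaFree_of_not_adj hxy (by rwa [hc.adj_iff hij hj]) (hlink₁ (by omega))
      (hlink₂ (by omega)) hear (hc.anticomplete_image_Icc (by omega) (by omega)) hanti₁ hanti₂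

include hG

/-- Otherwise the edge from `v` to `c i`, and the two paths through `c s` and through `c t` form a
theta graph. -/
theorem IsHole.eq_add_one_of_adj {v : V} {i s t : ℤ} (hv : v ∉ Set.range c) (hi : G.Adj v (c i))
    (hs : G.Adj v (c s)) (ht : G.Adj v (c t)) (his : i < s) (hst : s < t) (hti : t < i + N) :
    t = s + 1 := by
  by_contra hne
  have hvseg : ∀ l u, v ∉ c '' Set.Icc l u := fun l u h => hv (Set.image_subset_range _ _ h)
  have hlink₁ : Links G (c '' Set.Icc (i + 1) s) v (c i) :=
    ⟨hc.preconnected_image_Icc _ _, hvseg _ _, hc.notMem_image_Icc (by omega) (by omega),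
      ⟨c s, ⟨s, ⟨by omega, le_rfl⟩, rfl⟩, hs⟩,
      ⟨c (i + 1), ⟨i + 1, ⟨le_rfl, by omega⟩, rfl⟩, hc.adj_add_one i⟩⟩
  have hlink₂ : Links G (c '' Set.Icc t (i + N - 1)) v (c i) :=
    ⟨hc.preconnected_image_Icc _ _, hvseg _ _, hc.notMem_image_Icc (by omega) (by omega),
      ⟨c t, ⟨t, ⟨le_rfl, by omega⟩, rfl⟩, ht⟩,
      ⟨c (i + N - 1), ⟨i + N - 1, ⟨by omega, le_rfl⟩, rfl⟩,
        by simpa [hc.periodic i] using (hc.adj_add_one (i + N - 1)).symm⟩⟩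
  exact not_thetaFree_of_adj hi hlink₁ hlink₂ (hc.anticomplete_image_Icc (by omega) (by omega)) hG

/-- Three neighbours would be consecutive in each cyclic order, so the hole would be a triangle; and
if there are exactly two, then `{v}` is an ear. -/
theorem IsHole.eq_of_adj_of_adj {v x y : V} (hv : v ∉ Set.range c) (hx : x ∈ Set.range c)
    (hy : y ∈ Set.range c) (hvx : G.Adj v x) (hvy : G.Adj v y) : x = y := by
  by_contra hxy
  refine hc.not_thetaFree_of_ear hx hy hxy (Set.disjoint_singleton_right.2 hv)
    (links_singleton hvx.symm hvy.symm) (fun z hz hzd => ?_) hG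
  obtain ⟨d, hd, hvz⟩ := hzd
  rw [G.adj_comm, Set.mem_singleton_iff.1 hd] at hvz
  by_contra! hne
  obtain ⟨i, rfl⟩ := hx
  obtain ⟨s, his, hsN, rfl⟩ := hc.exists_between hy (Ne.symm hxy)
  obtain ⟨t, hit, htN, rfl⟩ := hc.exists_between hz hne.1
  wlog hst : s < t generalizing s t
  · exact this t hit htN hz hvz hne.1.symm s his hsN hy hvy ⟨Ne.symm hxy, hne.2.symm⟩
      (lt_of_le_of_ne (not_lt.1 hst) fun h => hne.2 (h ▸ rfl))
  have hperiodic : ∀ k, G.Adj v (c k) → G.Adj v (c (k + N)) := fun k hk => by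
    rwa [hc.periodic k]
  have h₁ := hc.eq_add_one_of_adj hG hv hvx hvy hvz his hst htN
  have h₂ := hc.eq_add_one_of_adj hG hv hvy hvz (hperiodic i hvx) hst htN (by omega)
  have h₃ := hc.eq_add_one_of_adj hG hv hvz (hperiodic i hvx) (hperiodic s hvy) htN
    (by omega) (by omega)
  have := hc.four_le
  omega

/-- Suppose that two vertices `x` and `y` of the hole can be joined by a path outside the hole. The
shortest such path, over all choices of `x` and `y`, is an ear. -/
theorem IsHole.eq_of_walk {x y d e : V} (hx : x ∈ Set.range c) (hy : y ∈ Set.range c)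
    (hxd : G.Adj x d) (hye : G.Adj y e) (p : G.Walk d e) (hp : ∀ z ∈ p.support, z ∉ Set.range c) :
    x = y := by
  classical
  by_contra hxy
  induction hn : p.length using Nat.strong_induction_on generalizing y e with | _ n ih
  subst hn
  refine hc.not_thetaFree_of_ear hx hy hxy (D := {z | z ∈ p.support})
    (Set.disjoint_right.2 hp)
    ⟨p.connected_induce_support.preconnected, fun h => hp x h hx, fun h => hp y h hy,
      ⟨d, p.start_mem_support, hxd⟩, ⟨e, p.end_mem_support, hye⟩⟩ (fun z hz ⟨w, hw, hzw⟩ => ?_) hG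
  by_contra! hne
  by_cases hwe : w = e
  · exact hne.2 (hc.eq_of_adj_of_adj hG (hp w hw) hz hy hzw.symm (hwe ▸ hye.symm))
  · exact ih _ (p.length_takeUntil_lt_length hw hwe) hz hzw (p.takeUntil w hw)
      (fun u hu => hp u (p.support_takeUntil_subset_support hw hu)) hne.1.symm rfl

theorem IsHole.range_eq_univ (hsep : ∀ A B, ¬ IsCliqueSeparation G A B) :
    Set.range c = Set.univ := by
  refine Set.eq_univ_of_forall fun v => ?_
  by_contra hv
  set D := componentIn G (Set.range c)ᶜ v
  have hrange : ∀ x ∈ outerBoundary G D, x ∈ Set.range c := fun x hx =>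
    not_not.1 (notMem_of_mem_outerBoundary_componentIn hx)
  have hsub : (outerBoundary G D).Subsingleton := by
    rintro x hx y hy
    obtain ⟨-, d, ⟨p, hp⟩, hxd⟩ := id hx
    obtain ⟨-, e, ⟨q, hq⟩, hye⟩ := id hy
    refine hc.eq_of_walk hG (hrange x hx) (hrange y hy) hxd hye (p.reverse.append q) fun z hz => ?_
    rw [Walk.mem_support_append_iff, Walk.support_reverse, List.mem_reverse] at hz
    exact hz.elim (hp z) (hq z)
  have hvD : v ∈ D := mem_componentIn_self (D := (Set.range c)ᶜ) hv
  refine hsep _ _ (isCliqueSeparation_of_isClique_outerBoundary ⟨v, hvD⟩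
    (hsub.pairwise _) fun huniv => ?_)
  have hmem : ∀ i, c i ∈ outerBoundary G D := fun i =>
    (huniv ▸ Set.mem_univ (c i)).resolve_left fun h => componentIn_subset h ⟨i, rfl⟩
  exact hc.ne zero_lt_one (by have := hc.four_le; omega) (hsub (hmem 0) (hmem 1))

end Ears

theorem IsHole.apply_eq_iff (hc : IsHole G N c) {i j : ℤ} (hi : 0 ≤ i) (hiN : i < N) (hj : 0 ≤ j)
    (hjN : j < N) : c i = c j ↔ i = j := by
  refine ⟨fun h => ?_, fun h => h ▸ rfl⟩
  rcases lt_trichotomy i j with hij | hij | hij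
  · exact absurd h (hc.ne hij (by omega))
  · exact hij
  · exact absurd h.symm (hc.ne hij (by omega))

/-- Triangulate the cycle by the chords from `c 0`. -/
theorem IsHole.hasTreeDecomposition (hc : IsHole G N c) (hrange : Set.range c = Set.univ) :
    HasTreeDecomposition G 3 := by
  classical
  have h4 := hc.four_le
  have hindex : ∀ x, ∃ q, 0 ≤ q ∧ q < N ∧ c q = x := fun x => by
    obtain ⟨k, rfl⟩ := hrange.ge (Set.mem_univ x)
    obtain ⟨q, ⟨h0, hq⟩, hkq⟩ := hc.periodic.exists_mem_Ico (by omega) k 0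
    exact ⟨q, h0, by omega, hkq.symm⟩
  let bag (t : Fin ((N - 3).toNat + 1)) : Finset V := {c 0, c (t + 1), c (t + 2)}
  have hbag : ∀ q, 0 ≤ q → q < N → ∀ t, c q ∈ bag t ↔ q = 0 ∨ q = t + 1 ∨ q = t + 2 := by
    intro q h0 hq t
    have := t.2
    simp only [bag, Finset.mem_insert, Finset.mem_singleton]
    rw [hc.apply_eq_iff h0 hq, hc.apply_eq_iff h0 hq, hc.apply_eq_iff h0 hq] <;> omega
  have hmem : ∀ r (hr : r < N), 0 ≤ r → c r ∈ bag ⟨(r - 2).toNat, by omega⟩ := fun r hr h0 => by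
    rw [hbag r h0 hr]
    dsimp only
    omega
  refine hasTreeDecomposition_of_path bag (fun _ => Finset.card_le_three) (fun x => ?_)
    (fun x y hxy => ?_) fun x => ⟨fun s hs t ht w hw => ?_⟩
  · obtain ⟨r, h0, hr, rfl⟩ := hindex x
    exact ⟨_, hmem r hr h0⟩
  · obtain ⟨q, hq0, hq, rfl⟩ := hindex x
    obtain ⟨r, hr0, hr, rfl⟩ := hindex y
    wlog hqr : q < r generalizing q r
    · have hrq : r < q := lt_of_le_of_ne (not_lt.1 hqr) (by rintro rfl; exact hxy.ne rfl)
      obtain ⟨t, ht⟩ := this r hr0 hr q hq0 hq hxy.symm hrq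
      exact ⟨t, ht.symm⟩
    · refine ⟨_, (hbag q hq0 hq _).2 ?_, hmem r hr hr0⟩
      have := (hc.adj_iff hqr (by omega)).1 hxy
      dsimp only
      omega
  · obtain ⟨q, h0, hq, rfl⟩ := hindex x
    simp only [Set.mem_ofPred_eq, hbag q h0 hq] at hs ht ⊢
    obtain ⟨hsw, hwt⟩ := hw
    rw [Fin.le_def] at hsw hwt
    omega

end Holes

theorem hasTreeDecomposition_of_thetaFree {V : Type v} [Finite V] {G : SimpleGraph V} {k : ℕ}
    (h3 : 3 ≤ k) (hk : G.CliqueFree (k + 1)) (hG : ThetaFree G) : HasTreeDecomposition G k := by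
  refine hasTreeDecomposition_of_atoms (k := k)
    (fun V G => G.CliqueFree (k + 1) ∧ ThetaFree G)
    (fun V G s h => ⟨h.1.comap ⟨(Embedding.induce s).toCopy⟩, fun n hn hn' hn'' =>
      h.2 n hn hn' (hn''.trans ⟨Embedding.induce s⟩)⟩) ?_ V G ⟨hk, hG⟩
  intro V _ G ⟨hk, hG⟩ hsep
  by_cases hle : Nat.card V ≤ k
  · exact hasTreeDecomposition_of_card_le G hle
  obtain ⟨a, b, hab, hadj⟩ := exists_not_adj_of_cliqueFree hk (by omega)
  obtain ⟨A, B, hAB⟩ | ⟨a, x, y, D, hxy, hnadj, hax, hay, hD, haD⟩ :=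
    exists_isCliqueSeparation_or_links hab hadj
  · exact absurd hAB (hsep A B)
  · obtain ⟨N, c, hc⟩ := exists_isHole_of_links hxy hnadj hax hay hD haD
    obtain ⟨ι, hι, T, hT⟩ := hc.hasTreeDecomposition (hc.range_eq_univ hG hsep)
    exact ⟨ι, hι, T, fun t => (hT t).trans h3⟩

/-! ### Binding functions -/

theorem IsInducedTopologicalMinor.trans_isIndContained {U : Type u} {V W : Type*}
    {H : SimpleGraph U} {G : SimpleGraph V} {K : SimpleGraph W}
    (h : IsInducedTopologicalMinor H G) (hG : G.IsIndContained K) :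
    IsInducedTopologicalMinor H K := by
  obtain ⟨W', H', hH', hind⟩ := h
  exact ⟨W', H', hH', hind.trans hG⟩

theorem isTwOmegaBinding_itmFree {U : Type u} {H : SimpleGraph U} {f : ℕ → ℕ}
    (h : ∀ (V : Type v) [Finite V] (G : SimpleGraph V), ¬ IsInducedTopologicalMinor H G →
      treewidth G ≤ f G.cliqueNum) : IsTwOmegaBinding (itmFree.{u, v} H) f :=
  fun _ _ _ hG s => h s _ fun hs => hG (hs.trans_isIndContained ⟨Embedding.induce s⟩)

theorem cliqueFree_cliqueNum_add_one {V : Type*} [Finite V] (G : SimpleGraph V) :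
    G.CliqueFree (G.cliqueNum + 1) := fun _ ht => by
  have := IsClique.card_le_cliqueNum (tc := ht.isClique)
  have := ht.card_eq
  omega

theorem isInducedTopologicalMinor_of_thetaGraph {U : Type u} {V ι : Type*} [Finite ι]
    {H : SimpleGraph U} {G : SimpleGraph V} {n₀ n : ι → ℕ} (hH : H.IsIndContained (thetaGraph n₀))
    (hn : n₀ ≤ n) (h0 : ∀ i j, n₀ i = 0 → n₀ j = 0 → i = j)
    (hG : (thetaGraph n).IsIndContained G) : IsInducedTopologicalMinor H G :=
  .of_isIndContained hH ((isIsoSubdivision_thetaGraph hn h0).isInducedTopologicalMinor hG)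

instance {m : ℕ} (n : Fin m → ℕ) : DecidableRel (thetaGraph n).Adj
  | .inl a, .inl b => inferInstanceAs (Decidable (a ≠ b ∧ ∃ i, n i = 0))
  | .inl a, .inr p =>
    inferInstanceAs (Decidable (a = false ∧ p.1.2 = 0 ∨ a = true ∧ p.1.2 + 1 = n p.1.1))
  | .inr p, .inl a =>
    inferInstanceAs (Decidable (a = false ∧ p.1.2 = 0 ∨ a = true ∧ p.1.2 + 1 = n p.1.1))
  | .inr p, .inr q =>
    inferInstanceAs (Decidable (p.1.1 = q.1.1 ∧ (p.1.2 + 1 = q.1.2 ∨ q.1.2 + 1 = p.1.2)))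

theorem cycleGraph_three_isIndContained_thetaGraph :
    (cycleGraph 3).IsIndContained (thetaGraph ![0, 1]) := by
  let f : Fin 3 → Bool ⊕ {p : Fin 2 × ℕ // p.2 < ![0, 1] p.1} :=
    ![.inl false, .inl true, .inr ⟨(1, 0), by decide⟩]
  have hf : f.Injective := by decide
  have hadj : ∀ i j, (thetaGraph _).Adj (f i) (f j) ↔ (cycleGraph 3).Adj i j := by decide
  exact ⟨⟨⟨f, hf⟩, hadj _ _⟩⟩

theorem cycleGraph_four_isIndContained_thetaGraph :
    (cycleGraph 4).IsIndContained (thetaGraph ![1, 1]) := by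
  let f : Fin 4 → Bool ⊕ {p : Fin 2 × ℕ // p.2 < ![1, 1] p.1} :=
    ![.inl false, .inr ⟨(0, 0), by decide⟩, .inl true, .inr ⟨(1, 0), by decide⟩]
  have hf : f.Injective := by decide
  have hadj : ∀ i j, (thetaGraph _).Adj (f i) (f j) ↔ (cycleGraph 4).Adj i j := by decide
  exact ⟨⟨⟨f, hf⟩, hadj _ _⟩⟩

theorem diamond_isIndContained_thetaGraph :
    diamond.IsIndContained (thetaGraph ![0, 1, 1]) := by
  let f : Fin 4 → Bool ⊕ {p : Fin 3 × ℕ // p.2 < ![0, 1, 1] p.1} :=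
    ![.inr ⟨(1, 0), by decide⟩, .inr ⟨(2, 0), by decide⟩, .inl false, .inl true]
  have hf : f.Injective := by decide
  have hadj : ∀ i j, (thetaGraph _).Adj (f i) (f j) ↔ i ≠ j ∧ s(i, j) ≠ s(0, 1) := by decide
  exact ⟨⟨⟨f, hf⟩, (hadj _ _).trans (by simp [diamond])⟩⟩

theorem isTwOmegaBinding_of_isIndContained_cycleGraph {U : Type u} {H : SimpleGraph U}
    (hH : H.IsIndContained (cycleGraph 3) ∨ H.IsIndContained (cycleGraph 4)) :
    IsTwOmegaBinding (itmFree.{u, v} H) (fun k => k - 1) := by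
  refine isTwOmegaBinding_itmFree fun V _ G hG => HasTreeDecomposition.treewidth_le <|
    hasTreeDecomposition_of_no_hole (cliqueFree_cliqueNum_add_one G) fun n hn hind => hG ?_
  have hn' : (![1, 1] : Fin 2 → ℕ) ≤ n := Fin.forall_fin_two.2
    ⟨Nat.one_le_iff_ne_zero.2 (hn 0), Nat.one_le_iff_ne_zero.2 (hn 1)⟩
  rcases hH with hH | hH
  · exact isInducedTopologicalMinor_of_thetaGraph
      (hH.trans cycleGraph_three_isIndContained_thetaGraph)
      (le_trans (Fin.forall_fin_two.2 (by decide)) hn') (by decide) hind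
  · exact isInducedTopologicalMinor_of_thetaGraph
      (hH.trans cycleGraph_four_isIndContained_thetaGraph) hn' (by decide) hind

theorem isTwOmegaBinding_of_iso_diamond {U : Type u} {H : SimpleGraph U}
    (hH : Nonempty (H ≃g diamond)) :
    IsTwOmegaBinding (itmFree.{u, v} H) (fun k => max (k - 1) 2) := by
  obtain ⟨e⟩ := hH
  refine isTwOmegaBinding_itmFree fun V _ G hG => ?_
  have hfree : ThetaFree G := fun n h1 h2 hind => hG <| isInducedTopologicalMinor_of_thetaGraph
    (IsIndContained.trans ⟨e.toEmbedding⟩ diamond_isIndContained_thetaGraph)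
    (Fin.forall_fin_succ.2 ⟨Nat.zero_le _, Fin.forall_fin_two.2
      ⟨Nat.one_le_iff_ne_zero.2 h1, Nat.one_le_iff_ne_zero.2 h2⟩⟩) (by decide) hind
  have hclique : G.CliqueFree (max G.cliqueNum 3 + 1) :=
    (cliqueFree_cliqueNum_add_one G).mono (by omega)
  have := (hasTreeDecomposition_of_thetaFree (le_max_right _ _) hclique hfree).treewidth_le
  omega

/-- Ramsey's theorem, by the recursion `R(k + 1, l + 1) ≤ R(k, l + 1) + R(k + 1, l)`: consider the
neighbours and the non-neighbours of one vertex. -/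
theorem exists_card_lt_of_cliqueFreeOn (k l : ℕ) :
    ∃ N, ∀ {V : Type u} (G : SimpleGraph V) (s : Finset V),
      G.CliqueFreeOn s k → Gᶜ.CliqueFreeOn s l → s.card < N := by
  classical
  induction k generalizing l with
  | zero => exact ⟨0, fun G s hk _ => absurd (isNClique_empty.2 rfl) (hk (t := ∅) (by simp))⟩
  | succ k ihk =>
    induction l with
    | zero => exact ⟨0, fun G s _ hl => absurd (isNClique_empty.2 rfl) (hl (t := ∅) (by simp))⟩
    | succ l ihl =>
      obtain ⟨N₁, h₁⟩ := ihk (l + 1)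
      obtain ⟨N₂, h₂⟩ := ihl
      refine ⟨N₁ + N₂ + 1, fun G s hk hl => ?_⟩
      obtain rfl | ⟨v, hv⟩ := s.eq_empty_or_nonempty
      · simp
      have hnbrs := h₁ G ((s.erase v).filter (G.Adj v))
        (.subset _ (fun w => by simp +contextual) (hk.of_succ _ hv))
        (.subset _ (fun w => by simp +contextual) hl)
      have hnonnbrs := h₂ G ((s.erase v).filter (¬ G.Adj v ·))
        (.subset _ (fun w => by simp +contextual) hk)
        (.subset _ (fun w => by simp +contextual [eq_comm]) (hl.of_succ _ hv))
      have hcard := (s.erase v).card_filter_add_card_filter_not (G.Adj v)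
      rw [Finset.card_erase_of_mem hv] at hcard
      omega

theorem card_lt_ramseyNumber {V : Type*} [Finite V] {G : SimpleGraph V} {k l : ℕ}
    (hk : G.CliqueFree k) (hl : Gᶜ.CliqueFree l) : Nat.card V < ramseyNumber k l := by
  have := Fintype.ofFinite V
  have hne : {n : ℕ | 0 < n ∧ ∀ m : ℕ, n ≤ m → ∀ G : SimpleGraph (Fin m),
      (∃ s, G.IsNClique k s) ∨ ∃ s, G.IsNIndepSet l s}.Nonempty := by
    obtain ⟨N, hN⟩ := exists_card_lt_of_cliqueFreeOn k l
    refine ⟨N + 1, N.succ_pos, fun m hm G => ?_⟩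
    by_contra! h
    have := hN G Finset.univ (fun t _ => h.1 t) fun t _ => mt (isNClique_compl G).1 (h.2 t)
    rw [Finset.card_univ, Fintype.card_fin] at this
    omega
  by_contra! hle
  let e : G ≃g _ := G.overFinIso Nat.card_eq_fintype_card.symm
  rcases (Nat.sInf_mem hne).2 _ hle (G.overFin Nat.card_eq_fintype_card.symm) with
    ⟨s, hs⟩ | ⟨s, hs⟩
  · exact hk.comap e.isContained' s hs
  · have hcompl := IsIndContained.compl ⟨e.symm.toEmbedding⟩
    exact hl.comap hcompl.isContained s ((isNClique_compl _).2 hs)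

theorem isTwOmegaBinding_bot (U : Type u) [Finite U] :
    IsTwOmegaBinding (itmFree.{u, v} (⊥ : SimpleGraph U))
      (fun k => ramseyNumber (k + 1) (Nat.card U) - 2) := by
  have := Fintype.ofFinite U
  refine isTwOmegaBinding_itmFree fun V _ G hG => ?_
  have hindep : Gᶜ.CliqueFree (Nat.card U) := by
    rw [Nat.card_eq_fintype_card, cliqueFree_iff_top_free]
    refine fun hU => hG ⟨U, ⊥, .refl, ?_⟩
    rwa [← compl_isIndContained_compl, compl_bot, top_isIndContained_iff_top_isContained]
  have hcard := card_lt_ramseyNumber (cliqueFree_cliqueNum_add_one G) hindep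
  have := (hasTreeDecomposition_of_card_le G le_rfl).treewidth_le
  omega

/-! ### Families of large treewidth -/

theorem card_le_treewidth_add_one_of_rows_of_columns {V κ : Type*} [Finite V] [Finite κ]
    {G : SimpleGraph V} (R C : κ → Set V) (hR : ∀ i, (G.induce (R i)).Preconnected)
    (hC : ∀ j, (G.induce (C j)).Preconnected) (hRR : Pairwise (Function.onFun Disjoint R))
    (hCC : Pairwise (Function.onFun Disjoint C))
    (hRC : ∀ i j, ∃ x ∈ R i, ∃ y ∈ C j, G.Adj x y) : Nat.card κ ≤ treewidth G + 1 := by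
  obtain _ | _ := isEmpty_or_nonempty κ
  · simp
  have hpos : 0 < Nat.card κ := Nat.card_pos
  rw [← Nat.sub_le_iff_le_add]
  refine le_treewidth_of_bramble (κ := κ × κ) (fun k => R k.1 ∪ C k.2) (fun k => ?_) (fun k l => ?_)
    fun X hX => ?_
  · obtain ⟨x, hx, y, hy, hxy⟩ := hRC k.1 k.2
    exact (connected_induce_union (hR _) (hC _) hx hy hxy).preconnected
  · obtain ⟨x, hx, y, hy, hxy⟩ := hRC k.1 l.2
    exact ⟨x, .inl hx, y, .inr hy, .inr hxy⟩
  · have card_le {L : κ → Set V} (hL : Pairwise (Function.onFun Disjoint L))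
        (hLX : ∀ i, ∃ x ∈ L i, x ∈ X) : Nat.card κ ≤ X.card := by
      choose g hg hgX using hLX
      have hinj : Function.Injective fun i => (⟨g i, hgX i⟩ : X) := fun i j hij => by
        by_contra hne
        exact Set.disjoint_left.1 (hL hne) (hg i) (Subtype.mk.inj hij ▸ hg j)
      simpa using Nat.card_le_card_of_injective _ hinj
    by_cases hcover : ∀ i, ∃ x ∈ R i, x ∈ X
    · have := card_le hRR hcover
      omega
    · push Not at hcover
      obtain ⟨i, hi⟩ := hcover
      have := card_le hCC fun j => by
        obtain ⟨x, hx | hx, hxX⟩ := hX (i, j)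
        exacts [absurd hxX (hi x hx), ⟨x, hx, hxX⟩]
      omega

theorem card_le_treewidth_completeBipartiteGraph_add_one (κ : Type*) [Finite κ] :
    Nat.card κ ≤ treewidth (completeBipartiteGraph κ κ) + 1 :=
  card_le_treewidth_add_one_of_rows_of_columns (fun i => {.inl i}) (fun j => {.inr j})
    (fun _ => .of_subsingleton) (fun _ => .of_subsingleton)
    (fun i j hij => by simpa [Function.onFun] using hij)
    (fun i j hij => by simpa [Function.onFun] using hij)
    fun i j => ⟨_, rfl, _, rfl, .inl ⟨rfl, rfl⟩⟩

theorem preconnected_lineGraph {V : Type*} {G : SimpleGraph V} (hG : G.Preconnected) :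
    G.lineGraph.Preconnected := by
  have reachable_of_walk : ∀ {x y : V}, G.Walk x y → ∀ e f : G.edgeSet, x ∈ e.1 → y ∈ f.1 →
      G.lineGraph.Reachable e f := by
    intro x y p
    induction p with
    | nil =>
      intro e f he hf
      obtain rfl | hne := eq_or_ne e f
      exacts [.rfl, (lineGraph_adj_iff_exists.2 ⟨hne, _, he, hf⟩).reachable]
    | @cons x x' _ h _ ih =>
      intro e f he hf
      have hstep : G.lineGraph.Reachable e ⟨s(x, x'), h⟩ := by
        obtain rfl | hne := eq_or_ne e ⟨s(x, x'), h⟩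
        exacts [.rfl, (lineGraph_adj_iff_exists.2 ⟨hne, x, he, Sym2.mem_mk_left _ _⟩).reachable]
      exact hstep.trans (ih _ _ (Sym2.mem_mk_right _ _) hf)
  intro e f
  obtain ⟨p⟩ := hG e.1.out.1 f.1.out.1
  exact reachable_of_walk p e f (Sym2.out_fst_mem _) (Sym2.out_fst_mem _)

theorem preconnected_induce_range {V W : Type*} {G : SimpleGraph V} {G' : SimpleGraph W}
    (f : G →g G') (hG : G.Preconnected) : (G'.induce (Set.range f)).Preconnected :=
  Set.image_univ ▸ preconnected_induce_image f ((induceUnivIso G).preconnected_iff.2 hG)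

theorem card_le_treewidth_lineGraph_boxProd_add_one {κ : Type*} [Finite κ] [Nontrivial κ]
    {G : SimpleGraph κ} (hG : G.Preconnected) :
    Nat.card κ ≤ treewidth (G □ G).lineGraph + 1 := by
  let row (i : κ) := (G.boxProdRight G i).toCopy.lineGraph
  let col (j : κ) := (G.boxProdLeft G j).toCopy.lineGraph
  have fst_eq {i : κ} {e} (he : e ∈ Set.range (row i)) {z} (hz : z ∈ e.1) : z.1 = i := by
    obtain ⟨e, rfl⟩ := he
    obtain ⟨a, -, rfl⟩ := Sym2.mem_map.1 hz
    rfl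
  have snd_eq {j : κ} {e} (he : e ∈ Set.range (col j)) {z} (hz : z ∈ e.1) : z.2 = j := by
    obtain ⟨e, rfl⟩ := he
    obtain ⟨a, -, rfl⟩ := Sym2.mem_map.1 hz
    rfl
  refine card_le_treewidth_add_one_of_rows_of_columns (fun i => Set.range (row i))
    (fun j => Set.range (col j)) 
    (fun i => preconnected_induce_range (row i).toHom (preconnected_lineGraph hG))
    (fun j => preconnected_induce_range (col j).toHom (preconnected_lineGraph hG)) ?_ ?_ ?_
  · exact fun i j hij => Set.disjoint_left.2 fun e hi hj =>
      hij ((fst_eq hi (Sym2.out_fst_mem _)).symm.trans (fst_eq hj (Sym2.out_fst_mem _)))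
  · exact fun i j hij => Set.disjoint_left.2 fun e hi hj =>
      hij ((snd_eq hi (Sym2.out_fst_mem _)).symm.trans (snd_eq hj (Sym2.out_fst_mem _)))
  · intro i j
    obtain ⟨i', hi⟩ := hG.exists_adj_of_nontrivial i
    obtain ⟨j', hj⟩ := hG.exists_adj_of_nontrivial j
    refine ⟨_, ⟨⟨s(j, j'), hj⟩, rfl⟩, _, ⟨⟨s(i, i'), hi⟩, rfl⟩, lineGraph_adj_iff_exists.2
      ⟨fun h => hj.ne' (snd_eq (z := (i, j')) ⟨⟨s(i, i'), hi⟩, h.symm⟩ (Sym2.mem_mk_right _ _)),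
        (i, j), Sym2.mem_mk_left _ _, Sym2.mem_mk_left _ _⟩⟩

theorem cliqueFree_lineGraph {V : Type*} {G : SimpleGraph V} [G.LocallyFinite] {d : ℕ}
    (hG : ∀ x, G.degree x ≤ d) : G.lineGraph.CliqueFree (2 * d + 1) := by
  classical
  intro s hs
  obtain ⟨⟨e, he⟩, hes⟩ : s.Nonempty := Finset.card_pos.1 (by rw [hs.card_eq]; omega)
  induction e with | _ x y
  have hsub : s.image Subtype.val ⊆ G.incidenceFinset x ∪ G.incidenceFinset y := by
    intro f hf
    obtain ⟨f, hfs, rfl⟩ := Finset.mem_image.1 hf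
    rw [Finset.mem_union, mem_incidenceFinset, mem_incidenceFinset]
    obtain rfl | hne := eq_or_ne f ⟨s(x, y), he⟩
    · exact .inl ⟨he, Sym2.mem_mk_left _ _⟩
    · obtain ⟨-, z, hzf, hz⟩ := lineGraph_adj_iff_exists.1 (hs.isClique hfs hes hne)
      obtain rfl | rfl := Sym2.mem_iff.1 hz
      exacts [.inl ⟨f.2, hzf⟩, .inr ⟨f.2, hzf⟩]
  have := (Finset.card_le_card hsub).trans (Finset.card_union_le _ _)
  rw [Finset.card_image_of_injective _ Subtype.val_injective, hs.card_eq,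
    card_incidenceFinset_eq_degree, card_incidenceFinset_eq_degree] at this
  have := hG x
  have := hG y
  omega

theorem IsTwOmegaBounded.exists_isInducedTopologicalMinor {U : Type u} {H : SimpleGraph U}
    (hH : IsTwOmegaBounded (itmFree.{u, v} H)) {V : ℕ → Type*} [∀ m, Finite (V m)]
    (G : ∀ m, SimpleGraph (V m)) {k : ℕ} (hω : ∀ m, (G m).CliqueFree (k + 1))
    (htw : ∀ m, m ≤ treewidth (G m)) : ∃ m, IsInducedTopologicalMinor H (G m) := by
  obtain ⟨f, hf⟩ := hH
  by_contra! hfree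
  let M := (Finset.range (k + 1)).sup f
  let G' := (G (M + 1)).map (equivShrink.{v} (V (M + 1)))
  let e : G (M + 1) ≃g G' := Iso.map _ _
  let e' : G (M + 1) ≃g G'.induce Set.univ := e.trans (induceUnivIso G').symm
  have hbound := hf _ G' (fun h => hfree _ (h.trans_isIndContained ⟨e.symm.toEmbedding⟩)) Set.univ
  have hclique : (G'.induce Set.univ).cliqueNum ≤ k := by
    obtain ⟨t, ht⟩ := (G'.induce Set.univ).exists_isNClique_cliqueNum
    by_contra! hlt
    exact ((hω _).mono hlt).comap e'.isContained' t ht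
  have hM := hbound.trans (Finset.le_sup (Finset.mem_range.2 (Nat.lt_succ_of_le hclique)))
  have htw' := ((hasTreeDecomposition_of_treewidth_le hM).of_iso e'.symm).treewidth_le
  exact Nat.not_succ_le_self M ((htw _).trans htw')

/-! ### Claws -/

/-- `G` has an induced claw `K_{1,3}`: a vertex with three pairwise nonadjacent neighbours. -/
def HasClaw {V : Type*} (G : SimpleGraph V) : Prop :=
  ∃ x s, G.IsNIndepSet 3 s ∧ ∀ a ∈ s, G.Adj x a

theorem HasClaw.of_isIndContained {V W : Type*} {G : SimpleGraph V} {G' : SimpleGraph W}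
    (h : HasClaw G) (hG : G.IsIndContained G') : HasClaw G' := by
  obtain ⟨f⟩ := hG
  obtain ⟨x, s, ⟨hs, hcard⟩, hx⟩ := h
  refine ⟨f x, s.map f.toEmbedding, ⟨?_, by rwa [Finset.card_map]⟩, ?_⟩
  · intro _ ha' _ hb' hab
    obtain ⟨a, ha, rfl⟩ := Finset.mem_map.1 ha'
    obtain ⟨b, hb, rfl⟩ := Finset.mem_map.1 hb'
    exact mt f.map_adj_iff.1 (hs ha hb fun h => hab (h ▸ rfl))
  · intro _ ha'
    obtain ⟨a, ha, rfl⟩ := Finset.mem_map.1 ha'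
    exact f.map_adj_iff.2 (hx a ha)

/-- If the subdivided edge belongs to the claw, then its new vertex replaces a leaf. -/
theorem HasClaw.subdivideEdge {V : Type*} {G : SimpleGraph V} (h : HasClaw G) (x y : V) :
    HasClaw (subdivideEdge G x y) := by
  classical
  obtain ⟨z, s, ⟨hs, hcard⟩, hz⟩ := h
  let leaf (a : V) : Option V := if s(z, a) = s(x, y) then none else some a
  have leaf_injective : leaf.Injective := fun a b hab => by
    grind
  refine ⟨some z, s.image leaf, ⟨?_, by rwa [Finset.card_image_of_injective _ leaf_injective]⟩, ?_⟩
  · intro _ ha' _ hb' hab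
    obtain ⟨a, ha, rfl⟩ := Finset.mem_image.1 ha'
    obtain ⟨b, hb, rfl⟩ := Finset.mem_image.1 hb'
    have hnadj := hs ha hb fun h => hab (congrArg leaf h)
    have hza := (hz a ha).ne
    have hzb := (hz b hb).ne
    simp only [leaf] at hab ⊢
    split_ifs <;> simp <;> grind
  · intro _ ha'
    obtain ⟨a, ha, rfl⟩ := Finset.mem_image.1 ha'
    have hadj := hz a ha
    simp only [leaf]
    split_ifs <;> simp <;> grind

theorem HasClaw.of_isSubdivision {U W : Type u} {H : SimpleGraph U} {K : SimpleGraph W}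
    (h : HasClaw H) (hK : IsSubdivision H W K) : HasClaw K := by
  induction hK with
  | refl => exact h
  | step _ _ ih => exact ih.subdivideEdge _ _

theorem not_hasClaw_lineGraph {V : Type*} (G : SimpleGraph V) : ¬ HasClaw G.lineGraph := by
  classical
  rintro ⟨e, s, ⟨hs, hcard⟩, he⟩
  have : Nonempty V := ⟨e.1.out.1⟩
  have hshared (a) (ha : a ∈ s) : ∃ z ∈ e.1, z ∈ a.1 := (lineGraph_adj_iff_exists.1 (he a ha)).2
  choose! z hze hza using hshared
  obtain ⟨a, ha, b, hb, hab, hz⟩ := Finset.exists_ne_map_eq_of_card_lt_of_maps_to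
    (t := e.1.toFinset) (by rw [Sym2.card_toFinset]; split_ifs <;> omega)
    fun a ha => Sym2.mem_toFinset.2 (hze a ha)
  exact hs ha hb hab (lineGraph_adj_iff_exists.2 ⟨hab, z a, hza a ha, hz ▸ hza b hb⟩)

/-! ### Graphs with a complete bipartite subdivision -/

/-- `G` is complete bipartite, possibly with an empty side; `c` tells the sides apart. -/
def IsCompleteBipartite {V : Type*} (G : SimpleGraph V) : Prop :=
  ∃ c : V → Bool, ∀ a b, G.Adj a b ↔ c a ≠ c b

/-- `G` is a book `K_{1,1,q}`, with spine `xy` and possibly without pages. -/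
def IsBook {V : Type*} (G : SimpleGraph V) : Prop :=
  ∃ x y, x ≠ y ∧ ∀ a b, G.Adj a b ↔ a ≠ b ∧ (a = x ∨ a = y ∨ b = x ∨ b = y)

theorem not_isBook_subdivideEdge {V : Type*} {G : SimpleGraph V} {x y : V} (hxy : x ≠ y) :
    ¬ IsBook (subdivideEdge G x y) := by
  rintro ⟨p, q, hpq, h⟩
  have hxy' : ¬ (subdivideEdge G x y).Adj (some x) (some y) := fun h => h.2 rfl
  have hnone (a : Option V) : (subdivideEdge G x y).Adj none a ↔ a = some x ∨ a = some y :=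
    subdivideEdge_adj_none_left
  simp only [h] at hxy' hnone
  have := hnone p
  have := hnone q
  grind

theorem isBook_of_isCompleteBipartite_subdivideEdge {V : Type*} {G : SimpleGraph V} {x y : V}
    (hxy : G.Adj x y) (h : IsCompleteBipartite (subdivideEdge G x y)) : IsBook G := by
  obtain ⟨c, hc⟩ := h
  have hnone (a : V) : c (some a) ≠ c none ↔ a = x ∨ a = y := by
    rw [← hc, subdivideEdge_adj_none_right, Option.some_inj, Option.some_inj]
  have hsome (a b : V) : G.Adj a b ∧ s(a, b) ≠ s(x, y) ↔ c (some a) ≠ c (some b) :=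
    subdivideEdge_adj_some.symm.trans (hc _ _)
  refine ⟨x, y, hxy.ne, fun a b => ?_⟩
  have := hnone a
  have := hnone b
  have := hsome a b
  have := hxy.symm
  have : G.Adj a b → a ≠ b := Adj.ne
  grind

theorem IsSubdivision.isCompleteBipartite_or_isBook {U W : Type u} {H : SimpleGraph U}
    {K : SimpleGraph W} (hK : IsSubdivision H W K) (h : IsCompleteBipartite K ∨ IsBook K) :
    IsCompleteBipartite H ∨ IsBook H := by
  induction hK with
  | refl => exact h
  | step _ hxy ih =>
    rcases h with h | h
    · exact ih (.inr (isBook_of_isCompleteBipartite_subdivideEdge hxy h))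
    · exact absurd h (not_isBook_subdivideEdge hxy.ne)

theorem isCompleteBipartite_completeBipartiteGraph (α β : Type*) :
    IsCompleteBipartite (completeBipartiteGraph α β) :=
  ⟨Sum.isLeft, by simp [completeBipartiteGraph]⟩

theorem IsCompleteBipartite.of_isIndContained {V W : Type*} {G : SimpleGraph V}
    {G' : SimpleGraph W} (h : IsCompleteBipartite G') (hG : G.IsIndContained G') :
    IsCompleteBipartite G := by
  obtain ⟨f⟩ := hG
  obtain ⟨c, hc⟩ := h
  exact ⟨c ∘ f, fun a b => f.map_adj_iff.symm.trans (hc _ _)⟩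

theorem hasClaw_of_adj {V : Type*} {G : SimpleGraph V} {x a b c : V} (ha : G.Adj x a)
    (hb : G.Adj x b) (hc : G.Adj x c) (hab : a ≠ b) (hac : a ≠ c) (hbc : b ≠ c)
    (hab' : ¬ G.Adj a b) (hac' : ¬ G.Adj a c) (hbc' : ¬ G.Adj b c) : HasClaw G := by
  classical
  refine ⟨x, {a, b, c}, ?_, by simp [ha, hb, hc]⟩
  rw [← isNClique_compl, is3Clique_triple_iff]
  simp [*]

theorem IsCompleteBipartite.isIndContained_cycleGraph_four {V : Type*} {G : SimpleGraph V}
    (h : IsCompleteBipartite G) (hne : G ≠ ⊥) (hclaw : ¬ HasClaw G) :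
    G.IsIndContained (cycleGraph 4) := by
  classical
  obtain ⟨c, hc⟩ := h
  obtain ⟨a, b, hab⟩ := G.ne_bot_iff_exists_adj.1 hne
  have hsurj : c.Surjective := fun t => by
    have := (hc a b).1 hab
    obtain h | h : c a = t ∨ c b = t := by cases t <;> grind
    exacts [⟨a, h⟩, ⟨b, h⟩]
  choose r hr using hsurj
  have hside {x y : V} (hxy : c x = c y) (hx : x ≠ r (c x)) (hy : y ≠ r (c x)) : x = y := by
    by_contra hne
    exact hclaw (hasClaw_of_adj (x := r (!c x)) (by simp [hc, hr]) (by simp [hc, hr, hxy])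
      (by simp [hc, hr]) hne hx hy (by simp [hc, hxy]) (by simp [hc, hr]) (by simp [hc, hr, hxy]))
  let g (t e : Bool) : Fin 4 := if t then (if e then 1 else 3) else (if e then 0 else 2)
  have hg : ∀ t e t' e', (cycleGraph 4).Adj (g t e) (g t' e') ↔ t ≠ t' := by decide
  have hginj : ∀ t e t' e', g t e = g t' e' → t = t' ∧ e = e' := by decide
  have hinj : Function.Injective fun x => g (c x) (decide (x = r (c x))) := fun x y hxy => by
    obtain ⟨hcxy, hrxy⟩ := hginj _ _ _ _ hxy
    grind
  exact ⟨⟨⟨_, hinj⟩, fun {x y} => (hg _ _ _ _).trans (hc x y).symm⟩⟩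

theorem IsBook.isIndContained_or_iso {V : Type*} {G : SimpleGraph V} (h : IsBook G)
    (hclaw : ¬ HasClaw G) : G.IsIndContained (cycleGraph 3) ∨ Nonempty (G ≃g diamond) := by
  classical
  obtain ⟨x, y, hxy, h⟩ := h
  by_cases hz : ∃ z w, z ≠ w ∧ ¬ G.Adj z w
  · right
    obtain ⟨z, w, hzw, hnadj⟩ := hz
    have hall (u : V) : u = z ∨ u = w ∨ u = x ∨ u = y := by
      by_contra! hu
      refine hclaw (hasClaw_of_adj (x := x) (a := z) (b := w) (c := u) ?_ ?_ ?_ ?_ ?_ ?_ ?_ ?_ ?_)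
      all_goals grind
    have hne : (z ≠ x ∧ z ≠ y) ∧ w ≠ x ∧ w ≠ y := by grind
    let f : Fin 4 → V := ![z, w, x, y]
    have hinj : f.Injective := by
      simp [f, Function.Injective, Fin.forall_fin_succ, hne, hzw, hxy, hne.1.1.symm,
        hne.1.2.symm, hne.2.1.symm, hne.2.2.symm, hzw.symm, hxy.symm]
    have hsurj : f.Surjective := fun u => by
      rcases hall u with rfl | rfl | rfl | rfl
      exacts [⟨0, rfl⟩, ⟨1, rfl⟩, ⟨2, rfl⟩, ⟨3, rfl⟩]
    have hadj (i j : Fin 4) : G.Adj (f i) (f j) ↔ diamond.Adj i j := by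
      rw [h, hinj.ne_iff]
      fin_cases i <;> fin_cases j <;> simp [f, diamond, hne]
    exact ⟨RelIso.symm ⟨.ofBijective f ⟨hinj, hsurj⟩, hadj _ _⟩⟩
  · left
    push Not at hz
    let f (u : V) : Fin 3 := if u = x then 0 else if u = y then 1 else 2
    have hf : f.Injective := fun u w huw => by
      have := hz u w
      have := h u w
      grind
    refine ⟨⟨⟨f, hf⟩, fun {u w} => ?_⟩⟩
    rw [cycleGraph_three_eq_top]
    exact hf.ne_iff.trans ⟨hz u w, Adj.ne⟩

theorem IsTwOmegaBounded.isIndContained_or_iso_or_eq_bot {U : Type u} {H : SimpleGraph U}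
    (hH : IsTwOmegaBounded (itmFree.{u, v} H)) :
    (H.IsIndContained (cycleGraph 3) ∨ H.IsIndContained (cycleGraph 4)) ∨
      Nonempty (H ≃g diamond) ∨ H = ⊥ := by
  obtain ⟨m, W, K, hHK, hK⟩ := hH.exists_isInducedTopologicalMinor (k := 2)
    (fun m => completeBipartiteGraph (Fin (m + 1)) (Fin (m + 1)))
    (fun m => Colorable.cliqueFree (CompleteBipartiteGraph.bicoloring _ _).colorable (by simp))
    fun m => by simpa using card_le_treewidth_completeBipartiteGraph_add_one (Fin (m + 1))
  obtain ⟨m', W', K', hHK', hK'⟩ := hH.exists_isInducedTopologicalMinor (k := 8)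
    (fun m => (cycleGraph (m + 3) □ cycleGraph (m + 3)).lineGraph)
    (fun m => cliqueFree_lineGraph (d := 4) fun x => by
      simp [degree_boxProd, cycleGraph_degree_three_le])
    (fun m => by
      have := card_le_treewidth_lineGraph_boxProd_add_one (cycleGraph_preconnected (n := m + 3))
      rw [Nat.card_fin] at this
      omega)
  have hclaw : ¬ HasClaw H := fun h =>
    not_hasClaw_lineGraph _ ((h.of_isSubdivision hHK').of_isIndContained hK')
  rcases hHK.isCompleteBipartite_or_isBook
    (.inl ((isCompleteBipartite_completeBipartiteGraph _ _).of_isIndContained hK)) with h | h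
  · by_cases hbot : H = ⊥
    · exact .inr (.inr hbot)
    · exact .inl (.inr (h.isIndContained_cycleGraph_four hbot hclaw))
  · exact (h.isIndContained_or_iso hclaw).imp .inl .inl

end TwOmega

theorem mainTheorem3 {U : Type u} [Finite U] (H : SimpleGraph U) :
    (TwOmega.IsTwOmegaBounded (TwOmega.itmFree.{u, v} H) ↔
      (H.IsIndContained (SimpleGraph.cycleGraph 3) ∨ H.IsIndContained (SimpleGraph.cycleGraph 4)) ∨
        Nonempty (H ≃g TwOmega.diamond) ∨
        H = ⊥) ∧
    ((H.IsIndContained (SimpleGraph.cycleGraph 3) ∨ H.IsIndContained (SimpleGraph.cycleGraph 4)) →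
      TwOmega.IsTwOmegaBinding (TwOmega.itmFree.{u, v} H) (fun k => k - 1)) ∧
    (Nonempty (H ≃g TwOmega.diamond) →
      TwOmega.IsTwOmegaBinding (TwOmega.itmFree.{u, v} H) (fun k => max (k - 1) 2)) ∧
    (H = ⊥ →
      TwOmega.IsTwOmegaBinding (TwOmega.itmFree.{u, v} H)
        (fun k => TwOmega.ramseyNumber (k + 1) (Nat.card U) - 2)) := by
  have hcycle := TwOmega.isTwOmegaBinding_of_isIndContained_cycleGraph.{u, v} (H := H)
  have hdiamond := TwOmega.isTwOmegaBinding_of_iso_diamond.{u, v} (H := H)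
  have hedgeless : H = ⊥ → TwOmega.IsTwOmegaBinding (TwOmega.itmFree.{u, v} H)
      (fun k => TwOmega.ramseyNumber (k + 1) (Nat.card U) - 2) := by
    rintro rfl
    exact TwOmega.isTwOmegaBinding_bot U
  refine ⟨⟨fun h => h.isIndContained_or_iso_or_eq_bot, ?_⟩, hcycle, hdiamond, hedgeless⟩
  rintro (h | h | h)
  exacts [⟨_, hcycle h⟩, ⟨_, hdiamond h⟩, ⟨_, hedgeless h⟩]
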